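/- Let $X$ be a non-empty zero-dimensional compact metric space, let $X_{\max}, X_{\min} \subseteq X$ be closed and let $\varphi : X \setminus X_{\max} \to X \setminus X_{\min}$ be a homeomorphism; that is, $(X, X_{\max}, X_{\min}, \varphi)$ is a partial dynamical system. For $n \ge 1$ let $\varphi^n$ and $\varphi^{-n}$ be the $n$-fold composites of the partial maps $\varphi$ and $\varphi^{-1}$, let $\varphi^0 = \mathrm{id}_X$, and write $\varphi^n(U) = \varphi^n(U \cap \mathrm{dom}(\varphi^n))$ for $U \subseteq X$. Give the equivalence relation $\mathcal{R} = \{(x, \varphi^n(x)) : n \in \mathbb{Z},\ x \in \mathrm{dom}(\varphi^n)\}$ the topology generated by the sets $\{(x,\varphi^n(x)) : x \in U \cap \mathrm{dom}(\varphi^n)\}$ with $n \in \mathbb{Z}$ and $U \subseteq X$ open. It is called an AF groupoid if, with this topology, it is a Hausdorff étale topological groupoid with unit space $X$ and is the union of an increasing sequence of compact open subsets, each of which is an equivalence relation on $X$. An ordered Bratteli diagram consists of finite non-empty sets $V_0, V_1, V_2, \dots$ with $V_0$ a singleton and, for $n \ge 1$, a finite partially ordered set $E_n$ with surjective maps $s_n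 : E_n \to V_{n-1}$ and $r_n : E_n \to V_n$ such that $e, e' \in E_n$ are comparable if and only if $r_n(e) = r_n(e')$. Its compactum is the space $B$ of all sequences $(e_n)_{n\ge1}$ with $e_n \in E_n$ and $r_n(e_n) = s_{n+1}(e_{n+1})$, with the topology inherited from the product of the discrete spaces $E_n$; $B_{\max}$ (respectively $B_{\min}$) is the set of those sequences all of whose entries are maximal (respectively minimal). The Veršik map $\psi : B \setminus B_{\max} \to B \setminus B_{\min}$ sends $(e_n)$ to $(f_n)$, where $k$ is the least index with $e_k$ not maximal, $f_k$ is the immediate successor of $e_k$, $(f_1, \dots, f_{k-1})$ is the unique path of minimal edges with $r_{k-1}(f_{k-1}) = s_k(f_k)$, and $f_n = e_n$ for $n > k$. Two partial dynamical systems $(X, X_{\max}, X_{\min}, \varphi)$ and $(X', X'_{\max}, X'_{\min}, \varphi')$ are conjugate if there is a homeomorphism $h : X \to X'$ with $h(X_{\max}) = X'_{\max}$, $h(X_{\min}) = X'_{\min}$ and $h \circ \varphi = \varphi' \circ h$. The following are equivalent: 1. $\varphi$ has no periodic points (there are no $n \ge 1$ and $x \in \mathrm{dom}(\varphi^n)$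 with $\varphi^n(x) = x$) and $\mathcal{R}$ is an AF groupoid; 2. $(X, X_{\max}, X_{\min}, \varphi)$ is conjugate to $(B, B_{\max}, B_{\min}, \psi)$ for some ordered Bratteli diagram; 3. for every clopen $U \supseteq X_{\min}$, $\bigcup_{n=0}^{\infty} \varphi^n(U) = X$; 4. for every clopen $V \supseteq X_{\max}$, $\bigcup_{n=0}^{\infty} \varphi^{-n}(V) = X$. -/

import Mathlib

open Set Topology

universe u v

/-- A partial dynamical system on `X`: closed sets `Xmax`, `Xmin` and a homeomorphism
`φ : X \ Xmax → X \ Xmin`. -/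
structure PartialDynamicalSystem (X : Type u) [TopologicalSpace X] where
  Xmax : Set X
  Xmin : Set X
  isClosed_max : IsClosed Xmax
  isClosed_min : IsClosed Xmin
  φ : ↥(Xmaxᶜ) ≃ₜ ↥(Xminᶜ)

namespace PartialDynamicalSystem

variable {X : Type u} [TopologicalSpace X] {Y : Type v} [TopologicalSpace Y]

/-- The inverse system, with partial homeomorphism `φ⁻¹`. -/
def symm (P : PartialDynamicalSystem X) : PartialDynamicalSystem X where
  Xmax := P.Xmin
  Xmin := P.Xmax
  isClosed_max := P.isClosed_min
  isClosed_min := P.isClosed_max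
  φ := P.φ.symm

/-- `φ` as a partial function on `X`, with domain `X \ Xmax`. -/
def map (P : PartialDynamicalSystem X) : X →. X :=
  fun x => ⟨x ∈ P.Xmaxᶜ, fun h => (P.φ ⟨x, h⟩ : X)⟩

/-- The `n`-fold composite of `φ` for a natural number `n`; the `0`-fold one is the identity. -/
def iterNat (P : PartialDynamicalSystem X) : ℕ → (X →. X)
  | 0 => PFun.id X
  | n + 1 => P.map.comp (P.iterNat n)

/-- `φⁿ` for an integer `n`: for negative `n`, the `|n|`-fold composite of `φ⁻¹`. -/
def iter (P : PartialDynamicalSystem X) : ℤ → (X →. X)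
  | Int.ofNat n => P.iterNat n
  | Int.negSucc n => P.symm.iterNat (n + 1)

/-- There is no point `x` in the domain of some `φⁿ`, `n ≥ 1`, with `φⁿ(x) = x`. -/
def Aperiodic (P : PartialDynamicalSystem X) : Prop :=
  ∀ (n : ℕ) (x : X), 1 ≤ n → x ∉ P.iterNat n x

/-- The orbit equivalence relation `ℛ = {(x, φⁿ(x)) : n ∈ ℤ, x ∈ dom φⁿ}`. -/
def orbitRel (P : PartialDynamicalSystem X) : Set (X × X) :=
  {p | ∃ n : ℤ, p.2 ∈ P.iter n p.1}

/-- The topology of `ℛ`, generated by the graphs of the restrictions of the `φⁿ`, `n ∈ ℤ`,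
to open subsets of `X`. -/
@[reducible]
def orbitTopology (P : PartialDynamicalSystem X) : TopologicalSpace ↥P.orbitRel :=
  TopologicalSpace.generateFrom
    {W | ∃ (n : ℤ) (U : Set X), IsOpen U ∧
      W = {p | p.1.1 ∈ U ∧ p.1.2 ∈ P.iter n p.1.1}}

/-- Conjugacy of partial dynamical systems; the last clause is the equality `h ∘ φ₁ = φ₂ ∘ h`
of partial maps. -/
def IsConjugate (P : PartialDynamicalSystem X) (Q : PartialDynamicalSystem Y) : Prop :=
  ∃ h : X ≃ₜ Y, h '' P.Xmax = Q.Xmax ∧ h '' P.Xmin = Q.Xmin ∧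
    ∀ x : X, (P.map x).map h = Q.map (h x)

end PartialDynamicalSystem

/-- The equivalence relation `R` on `X`, regarded as a groupoid with unit space `X` and given the
topology `T`, is a Hausdorff étale topological groupoid: inversion and composition are continuous
and the range map is a local homeomorphism onto the unit space. -/
structure IsEtaleRelation {X : Type u} [TopologicalSpace X] (R : Set (X × X))
    (T : TopologicalSpace ↥R) : Prop where
  equivalence : Equivalence (fun x y : X => (x, y) ∈ R)
  t2 : T2Space ↥R
  continuous_inv : Continuous fun p : ↥R => (⟨(p.1.2, p.1.1), equivalence.symm p.2⟩ : ↥R)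
  continuous_mul : Continuous fun q : {q : ↥R × ↥R // q.1.1.2 = q.2.1.1} =>
    (⟨(q.1.1.1.1, q.1.2.1.2), equivalence.trans (y := q.1.1.1.2) q.1.1.2
      (by rw [q.2]; exact q.1.2.2)⟩ : ↥R)
  isLocalHomeomorph : IsLocalHomeomorph fun p : ↥R => p.1.1

/-- The equivalence relation `R` on the zero-dimensional compact space `X`, with the topology `T`,
is an AF groupoid: it is an étale groupoid and the union of an increasing sequence of compact open
subgroupoids `K n` with the same unit space `X` (compact open subequivalence relations on `X`). -/
def IsAFGroupoid {X : Type u} [TopologicalSpace X] (R : Set (X × X))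
    (T : TopologicalSpace ↥R) : Prop :=
  IsEtaleRelation R T ∧
    ∃ K : ℕ → Set ↥R, Monotone K ∧ (⋃ n, K n) = univ ∧
      ∀ n, IsCompact (K n) ∧ IsOpen (K n) ∧
        Equivalence (fun x y : X => ∃ h : (x, y) ∈ R, (⟨(x, y), h⟩ : ↥R) ∈ K n)

/-- An ordered Bratteli diagram. `E n` is the set of edges from `V n` to `V (n + 1)`. -/
structure OrderedBratteliDiagram where
  V : ℕ → Type u
  E : ℕ → Type u
  finite_V : ∀ n, Finite (V n)
  finite_E : ∀ n, Finite (E n)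
  nonempty_V : ∀ n, Nonempty (V n)
  subsingleton_V_zero : Subsingleton (V 0)
  s : ∀ {n}, E n → V n
  r : ∀ {n}, E n → V (n + 1)
  s_surjective : ∀ n, Function.Surjective (s (n := n))
  r_surjective : ∀ n, Function.Surjective (r (n := n))
  order : ∀ n, PartialOrder (E n)
  comparable_iff : ∀ {n} (e e' : E n), (e ≤ e' ∨ e' ≤ e) ↔ r e = r e'

namespace OrderedBratteliDiagram

attribute [instance] finite_V finite_E nonempty_V order

/-- The edge sets are discrete. -/
instance (B : OrderedBratteliDiagram.{u}) (n : ℕ) : TopologicalSpace (B.E n) := ⊥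

instance (B : OrderedBratteliDiagram.{u}) (n : ℕ) : DiscreteTopology (B.E n) := ⟨rfl⟩

/-- The space of infinite paths, with the topology inherited from the product of the discrete
spaces `E n`, that is, the one generated by the cylinder sets. -/
abbrev Path (B : OrderedBratteliDiagram.{u}) : Type u :=
  {x : ∀ n, B.E n // ∀ n, B.r (x n) = B.s (x (n + 1))}

/-- The maximal paths. -/
def maxPaths (B : OrderedBratteliDiagram.{u}) : Set B.Path := {x | ∀ n, IsMax (x.1 n)}

/-- The minimal paths. -/
def minPaths (B : OrderedBratteliDiagram.{u}) : Set B.Path := {x | ∀ n, IsMin (x.1 n)}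

/-- `y` is the Veršik successor of `x`: the first non-maximal edge `x k` of `x` is replaced by its
immediate successor, the edges before it by minimal ones, and the later edges are kept. -/
def Step (B : OrderedBratteliDiagram.{u}) (x y : B.Path) : Prop :=
  ∃ k, (∀ i < k, IsMax (x.1 i)) ∧ x.1 k ⋖ y.1 k ∧ (∀ i < k, IsMin (y.1 i)) ∧
    ∀ i, k < i → y.1 i = x.1 i

/-- The diagram with all orders reversed. -/
abbrev dual (B : OrderedBratteliDiagram.{u}) : OrderedBratteliDiagram.{u} where
  V := B.V
  E := fun n => (B.E n)ᵒᵈ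
  finite_V := B.finite_V
  finite_E := B.finite_E
  nonempty_V := B.nonempty_V
  subsingleton_V_zero := B.subsingleton_V_zero
  s := B.s
  r := B.r
  s_surjective := B.s_surjective
  r_surjective := B.r_surjective
  order := fun _ => inferInstance
  comparable_iff := fun e e' => (or_comm.trans (B.comparable_iff
    (OrderDual.ofDual e) (OrderDual.ofDual e')) :)

theorem step_dual {B : OrderedBratteliDiagram.{u}} {x y : B.Path} (h : B.Step x y) :
    B.dual.Step y x := by
  obtain ⟨k, h1, h2, h3, h4⟩ := h
  exact ⟨k, fun i hi => (h3 i hi).toDual, h2.toDual, fun i hi => (h1 i hi).toDual,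
    fun i hi => (h4 i hi).symm⟩

theorem step_of_dual {B : OrderedBratteliDiagram.{u}} {x y : B.Path} (h : B.dual.Step y x) :
    B.Step x y := by
  obtain ⟨k, h1, h2, h3, h4⟩ := h
  exact ⟨k, fun i hi b hb => h3 i hi (b := b) hb, ⟨h2.1, fun c h h' => h2.2 (c := c) h' h⟩,
    fun i hi b hb => h1 i hi (b := b) hb, fun i hi => (h4 i hi).symm⟩

variable {B : OrderedBratteliDiagram.{u}}

theorem r_eq_of_le {n : ℕ} {e f : B.E n} (h : e ≤ f) : B.r e = B.r f :=
  (B.comparable_iff e f).1 (Or.inl h)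

theorem eq_of_isMin {n : ℕ} {e f : B.E n} (he : IsMin e) (hf : IsMin f) (h : B.r e = B.r f) :
    e = f := by
  rcases (B.comparable_iff e f).2 h with h | h
  · exact hf.eq_of_le h
  · exact (he.eq_of_le h).symm

theorem exists_isMin {n : ℕ} (v : B.V (n + 1)) : ∃ e : B.E n, IsMin e ∧ B.r e = v := by
  obtain ⟨e, rfl⟩ := B.r_surjective n v
  obtain ⟨m, hm, hmin⟩ := Finite.exists_le_minimal (p := fun _ : B.E n => True) (a := e) trivial
  exact ⟨m, fun a ha => hmin.2 trivial ha, r_eq_of_le hm⟩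

theorem exists_min_path : ∀ (n : ℕ) (e : B.E n), ∃ p : ∀ i, B.E i, p n = e ∧
    (∀ i < n, B.r (p i) = B.s (p (i + 1))) ∧ ∀ i < n, IsMin (p i)
  | 0, e => by
    choose m hm using fun i => exists_isMin (B := B) (n := i) (Classical.arbitrary _)
    exact ⟨Function.update m 0 e, by simp, by simp, by simp⟩
  | n + 1, e => by
    obtain ⟨m, hm, hr⟩ := exists_isMin (B.s e)
    obtain ⟨p, h1, h2, h3⟩ := exists_min_path n m
    refine ⟨Function.update p (n + 1) e, by simp, fun i hi => ?_, fun i hi => ?_⟩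
    · rw [Function.update_of_ne (by omega)]
      rcases Nat.lt_succ_iff_lt_or_eq.1 hi with hi | rfl
      · rw [Function.update_of_ne (by omega)]
        exact h2 i hi
      · rw [Function.update_self, h1, hr]
    · rw [Function.update_of_ne (by omega)]
      rcases Nat.lt_succ_iff_lt_or_eq.1 hi with hi | rfl
      · exact h3 i hi
      · rw [h1]; exact hm

/-- Replacing the first edges of a path. -/
theorem exists_splice (x : B.Path) (p : ∀ i, B.E i) (k : ℕ)
    (hp : ∀ i < k, B.r (p i) = B.s (p (i + 1))) (hk : B.r (p k) = B.r (x.1 k)) :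
    ∃ y : B.Path, (∀ i ≤ k, y.1 i = p i) ∧ ∀ i, k < i → y.1 i = x.1 i := by
  refine ⟨⟨fun i => if i ≤ k then p i else x.1 i, fun i => ?_⟩, fun i hi => if_pos hi,
    fun i hi => if_neg (by omega)⟩
  rcases lt_trichotomy i k with h | rfl | h
  · simpa [h.le, Nat.succ_le_of_lt h] using hp i h
  · simpa [hk] using x.2 i
  · simpa [h.not_ge, show ¬ i + 1 ≤ k by omega] using x.2 i

theorem Step.notMem_max {x y : B.Path} (h : B.Step x y) : x ∈ B.maxPathsᶜ := by
  obtain ⟨k, -, h2, -⟩ := h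
  exact fun hx => h2.lt.not_isMax (hx k)

theorem Step.notMem_min {x y : B.Path} (h : B.Step x y) : y ∈ B.minPathsᶜ := by
  obtain ⟨k, -, h2, -⟩ := h
  exact fun hx => h2.lt.not_isMin (hx k)

theorem exists_step {x : B.Path} (hx : x ∈ B.maxPathsᶜ) : ∃ y, B.Step x y := by
  classical
  have hx' : ∃ n, ¬ IsMax (x.1 n) := not_forall.1 hx
  obtain ⟨k, hk, hlt⟩ : ∃ k, ¬ IsMax (x.1 k) ∧ ∀ i < k, IsMax (x.1 i) :=
    ⟨Nat.find hx', Nat.find_spec hx', fun i hi => not_not.1 (Nat.find_min hx' hi)⟩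
  obtain ⟨e, he⟩ := exists_covBy_of_wellFoundedLT hk
  obtain ⟨p, h1, h2, h3⟩ := exists_min_path k e
  obtain ⟨y, hy1, hy2⟩ := exists_splice x p k h2 (by rw [h1]; exact (r_eq_of_le he.le).symm)
  refine ⟨y, k, hlt, ?_, fun i hi => ?_, hy2⟩
  · rw [hy1 k le_rfl, h1]; exact he
  · rw [hy1 i hi.le]; exact h3 i hi

theorem Step.unique {x y z : B.Path} (hy : B.Step x y) (hz : B.Step x z) : y = z := by
  obtain ⟨k, h1, h2, h3, h4⟩ := hy
  obtain ⟨l, g1, g2, g3, g4⟩ := hz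
  obtain rfl : k = l := by
    rcases lt_trichotomy k l with h | h | h
    · exact absurd (g1 k h) h2.lt.not_isMax
    · exact h
    · exact absurd (h1 l h) g2.lt.not_isMax
  have hk : y.1 k = z.1 k := by
    rcases (B.comparable_iff (y.1 k) (z.1 k)).2
      ((r_eq_of_le h2.le).symm.trans (r_eq_of_le g2.le)) with h | h
    · rcases h.lt_or_eq with h | h
      · exact absurd h (g2.2 h2.lt)
      · exact h
    · rcases h.lt_or_eq with h | h
      · exact absurd h (h2.2 g2.lt)
      · exact h.symm
  have hlow : ∀ j, j ≤ k → y.1 (k - j) = z.1 (k - j) := by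
    intro j
    induction j with
    | zero => intro _; exact hk
    | succ j ih =>
      intro hj
      have e : k - j = k - (j + 1) + 1 := by omega
      have hs := ih (by omega)
      rw [e] at hs
      refine eq_of_isMin (h3 _ (by omega)) (g3 _ (by omega)) ?_
      rw [y.2, z.2, hs]
  refine Subtype.ext (funext fun i => ?_)
  rcases le_or_gt i k with h | h
  · have := hlow (k - i) (by omega)
    rwa [show k - (k - i) = i by omega] at this
  · rw [h4 i h, g4 i h]

theorem continuous_apply (n : ℕ) :
    Continuous fun x : B.Path => x.1 n :=
  (_root_.continuous_apply n).comp continuous_subtype_val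

theorem isOpen_agree (x : B.Path) (n : ℕ) : IsOpen {z : B.Path | ∀ i ≤ n, z.1 i = x.1 i} := by
  have h : {z : B.Path | ∀ i ≤ n, z.1 i = x.1 i} =
      ⋂ i ∈ Set.Iic n, {z : B.Path | z.1 i = x.1 i} := by
    ext z; simp
  rw [h]
  exact (Set.finite_Iic n).isOpen_biInter fun i _ =>
    (isOpen_discrete {x.1 i}).preimage (continuous_apply i)

theorem isClosed_maxPaths (B : OrderedBratteliDiagram.{u}) : IsClosed B.maxPaths := by
  have h : B.maxPaths = ⋂ i, {z : B.Path | IsMax (z.1 i)} := by ext z; simp [maxPaths]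
  rw [h]
  exact isClosed_iInter fun i =>
    (isClosed_discrete {e : B.E i | IsMax e}).preimage (continuous_apply i)

theorem isClosed_minPaths (B : OrderedBratteliDiagram.{u}) : IsClosed B.minPaths := by
  have h : B.minPaths = ⋂ i, {z : B.Path | IsMin (z.1 i)} := by ext z; simp [minPaths]
  rw [h]
  exact isClosed_iInter fun i =>
    (isClosed_discrete {e : B.E i | IsMin e}).preimage (continuous_apply i)

/-- A map whose graph consists of steps is continuous. -/
theorem continuous_of_step {S T : Set B.Path} (f : ↥S → ↥T)
    (hf : ∀ x : ↥S, B.Step x (f x)) : Continuous f := by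
  refine Continuous.subtype_mk (f := fun x => ((f x : ↥T) : B.Path))
    (continuous_induced_rng.2 (continuous_pi fun n => ?_)) _
  refine continuous_iff_continuousAt.2 fun x => ?_
  obtain ⟨k, h1, h2, h3, h4⟩ := hf x
  refine ContinuousAt.congr (f := fun _ => (f x : B.Path).1 n) continuousAt_const ?_
  have hU := (isOpen_agree x.1 (max k n)).preimage (continuous_subtype_val (p := (· ∈ S)))
  filter_upwards [hU.mem_nhds (by intro i _; rfl)] with z hz
  have hz : ∀ i ≤ max k n, z.1.1 i = x.1.1 i := hz
  obtain ⟨y, hy1, hy2⟩ := exists_splice z.1 (f x : B.Path).1 k (fun i _ => (f x : B.Path).2 i)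
    (by rw [hz k (le_max_left _ _)]; exact (r_eq_of_le h2.le).symm)
  have hstep : B.Step z.1 y := by
    refine ⟨k, fun i hi => ?_, ?_, fun i hi => ?_, hy2⟩
    · rw [hz i (hi.le.trans (le_max_left _ _))]; exact h1 i hi
    · rw [hz k (le_max_left _ _), hy1 k le_rfl]; exact h2
    · rw [hy1 i hi.le]; exact h3 i hi
  show (f x : B.Path).1 n = (f z : B.Path).1 n
  rw [(hf z).unique hstep]
  rcases le_or_gt n k with h | h
  · rw [hy1 n h]
  · rw [hy2 n h, h4 n h, hz n (le_max_right _ _)]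

theorem exists_step_to {y : B.Path} (hy : y ∈ B.minPathsᶜ) : ∃ x, B.Step x y := by
  obtain ⟨x, hx⟩ := exists_step (B := B.dual) (x := y)
    (fun h => hy fun n b hb => h n (b := b) hb)
  exact ⟨x, step_of_dual hx⟩

/-- The Veršik partial dynamical system: `φ` maps each non-maximal path to its successor. -/
noncomputable def vershik (B : OrderedBratteliDiagram.{u}) : PartialDynamicalSystem B.Path where
  Xmax := B.maxPaths
  Xmin := B.minPaths
  isClosed_max := B.isClosed_maxPaths
  isClosed_min := B.isClosed_minPaths
  φ :=
    { toFun := fun x => ⟨(exists_step x.2).choose, (exists_step x.2).choose_spec.notMem_min⟩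
      invFun := fun y =>
        ⟨(exists_step_to y.2).choose, (exists_step_to y.2).choose_spec.notMem_max⟩
      left_inv := fun x =>
        have h := (exists_step x.2).choose_spec
        Subtype.ext <| Step.unique (B := B.dual)
          (step_dual (exists_step_to h.notMem_min).choose_spec) (step_dual h)
      right_inv := fun y =>
        have h := (exists_step_to y.2).choose_spec
        Subtype.ext <| Step.unique (exists_step h.notMem_max).choose_spec h
      continuous_toFun := continuous_of_step _ fun x => (exists_step x.2).choose_spec
      continuous_invFun := continuous_of_step (B := B.dual) (S := B.minPathsᶜ)
        (T := B.maxPathsᶜ) _ fun y => step_dual (exists_step_to y.2).choose_spec }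

theorem vershik_step (B : OrderedBratteliDiagram.{u}) (x : ↥(B.maxPathsᶜ)) :
    B.Step x.1 (B.vershik.φ x).1 :=
  (exists_step x.2).choose_spec

end OrderedBratteliDiagram

/-!
All four conditions are shown to be equivalent to the absence of a nonempty closed set `K` with
`φ(K) = K` (`NoInvariantSet`), a condition that does not change when `φ` is replaced by `φ⁻¹`.

* *Clopen neighbourhoods* (`noInvariantSet_iff`). A closed set with `φ(K) = K` is disjoint from
  `Xmin`, and a clopen neighbourhood of `Xmin` that misses `K` has no forward image meeting `K`.
  Conversely, if the points whose backward orbit never meets a clopen `U ⊇ Xmin` form a nonempty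
  set, then the intersection of its images under `φ⁻ⁿ` is invariant.

* *Towers.* If there is no invariant set and `U ⊇ Xmin` is clopen, then `φ` moves each point of `U`
  up a finite tower, until `φ` is undefined or leads back into `U`; the towers have bounded
  height and partition the space, and the position in a tower (`depth`) and its bottom (`base`)
  are continuous. For a decreasing sequence of clopen `U n` with intersection `Xmin` and `U 0 = X`,
  each tower over `U (n + 1)` is stacked from towers over `U n`, and any finite piece of an orbit
  finally lies in a single tower.

* *AF groupoids* (`NoInvariantSet.isAFGroupoid`, `noInvariantSet_of_isAFGroupoid`). To lie in the
  same tower over `U n` is a compact open equivalence relation, and these exhaust the orbit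
  relation. Conversely, on an invariant set the relations `(x, φ(x))` lie by compactness in
  a single compact open equivalence relation, which then contains all `(x, φⁿ(x))` and so
  meets infinitely many of the disjoint graphs of the `φⁿ`.

* *Bratteli diagrams* (`NoInvariantSet.exists_isConjugate_vershik`,
  `OrderedBratteliDiagram.noInvariantSet_vershik`). The towers over `U n` are divided into finitely
  many clopen classes (`label`) in such a way that the class of a tower over `U (n + 1)` determines
  the sequence of the classes of the towers over `U n` from which it is stacked. The classes
  are the vertices of a diagram, and the positions of small towers in large ones are its
  ordered edges. A point is sent to the path of its positions, and `φ` to the Veršik map, because a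
  step of `φ` either stays in a small tower or leads from its top to the bottom of the next.
  Conversely, on an invariant set of paths the Veršik map would change boundedly many edges only and
  increase them forever in a finite lexicographic order.
-/

/-! ### Partial maps and their iterates -/

namespace PartialDynamicalSystem

section Iterates

variable {X : Type u} [TopologicalSpace X] {P : PartialDynamicalSystem X}

theorem mem_map_symm {x y : X} : x ∈ P.symm.map y ↔ y ∈ P.map x := by
  constructor
  · rintro ⟨h, rfl⟩
    exact ⟨(P.φ.symm ⟨y, h⟩).2, congrArg Subtype.val (P.φ.apply_symm_apply ⟨y, h⟩)⟩
  · rintro ⟨h, rfl⟩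
    exact ⟨(P.φ ⟨x, h⟩).2, congrArg Subtype.val (P.φ.symm_apply_apply ⟨x, h⟩)⟩

theorem mem_map_unique {x y z : X} (hy : y ∈ P.map x) (hz : z ∈ P.map x) : y = z :=
  Part.mem_unique hy hz

theorem mem_map_injective {x y z : X} (hx : z ∈ P.map x) (hy : z ∈ P.map y) : x = y :=
  mem_map_unique (mem_map_symm.2 hx) (mem_map_symm.2 hy)

theorem notMem_min_of_mem_map {x y : X} (h : y ∈ P.map x) : y ∉ P.Xmin := by
  obtain ⟨h, rfl⟩ := h
  exact (P.φ ⟨x, h⟩).2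

theorem notMem_max_of_mem_map {x y : X} (h : y ∈ P.map x) : x ∉ P.Xmax := h.1

theorem exists_mem_map {x : X} (h : x ∉ P.Xmax) : ∃ y, y ∈ P.map x := ⟨_, h, rfl⟩

theorem exists_mem_map_to {y : X} (h : y ∉ P.Xmin) : ∃ x, y ∈ P.map x :=
  (exists_mem_map (P := P.symm) h).imp fun _ => mem_map_symm.1

theorem isOpen_preimage_map {V : Set X} (hV : IsOpen V) : IsOpen {x | ∃ y ∈ V, y ∈ P.map x} := by
  have h : {x | ∃ y ∈ V, y ∈ P.map x} =
      (fun x : ↥(P.Xmaxᶜ) => (x : X)) '' ((fun x => (P.φ x : X)) ⁻¹' V) := by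
    ext x
    constructor
    · rintro ⟨_, hy, h, rfl⟩
      exact ⟨⟨x, h⟩, hy, rfl⟩
    · rintro ⟨⟨x, h⟩, hx, rfl⟩
      exact ⟨_, hx, h, rfl⟩
  rw [h]
  exact P.isClosed_max.isOpen_compl.isOpenMap_subtype_val _
    (hV.preimage (continuous_subtype_val.comp P.φ.continuous))

theorem mem_iterNat_zero {x y : X} : y ∈ P.iterNat 0 x ↔ y = x := Part.mem_some_iff

theorem mem_iterNat_succ {n : ℕ} {x z : X} :
    z ∈ P.iterNat (n + 1) x ↔ ∃ y, y ∈ P.iterNat n x ∧ z ∈ P.map y := Part.mem_bind_iff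

theorem mem_iterNat_add {m n : ℕ} {x z : X} :
    z ∈ P.iterNat (m + n) x ↔ ∃ y, y ∈ P.iterNat m x ∧ z ∈ P.iterNat n y := by
  induction n generalizing z with
  | zero => simp [mem_iterNat_zero]
  | succ n ih =>
    rw [← add_assoc, mem_iterNat_succ]
    simp only [ih, mem_iterNat_succ]
    tauto

theorem mem_iterNat_one {x y : X} : y ∈ P.iterNat 1 x ↔ y ∈ P.map x := by
  simp [mem_iterNat_succ (n := 0), mem_iterNat_zero]

theorem mem_iterNat_symm {n : ℕ} {x y : X} : x ∈ P.symm.iterNat n y ↔ y ∈ P.iterNat n x := by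
  induction n generalizing x with
  | zero => rw [mem_iterNat_zero, mem_iterNat_zero, eq_comm]
  | succ n ih =>
    rw [mem_iterNat_succ, add_comm n 1, mem_iterNat_add]
    simp only [ih, mem_map_symm, mem_iterNat_one]
    tauto

theorem mem_iterNat_injective {n : ℕ} {x y z : X} (hx : z ∈ P.iterNat n x)
    (hy : z ∈ P.iterNat n y) : x = y :=
  Part.mem_unique (mem_iterNat_symm.2 hx) (mem_iterNat_symm.2 hy)

/-- Two points from which a common point is reached lie on one orbit, the longer way first. -/
theorem mem_iterNat_sub {m n : ℕ} (hmn : m ≤ n) {u w y : X} (hu : y ∈ P.iterNat m u)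
    (hw : y ∈ P.iterNat n w) : u ∈ P.iterNat (n - m) w := by
  rw [← Nat.sub_add_cancel hmn, mem_iterNat_add] at hw
  obtain ⟨u', hu', hy⟩ := hw
  rwa [mem_iterNat_injective hu hy]

theorem iter_natCast (n : ℕ) : P.iter (n : ℤ) = P.iterNat n := rfl

theorem iter_neg_natCast (n : ℕ) : P.iter (-(n : ℤ)) = P.symm.iterNat n := by
  cases n <;> rfl

/-- The graph of `φⁿ`, `n ∈ ℤ`, in terms of forward iterates from a common point. -/
theorem mem_iter {n : ℤ} {x y : X} :
    y ∈ P.iter n x ↔ ∃ (a b : ℕ) (u : X), n = b - a ∧ x ∈ P.iterNat a u ∧ y ∈ P.iterNat b u := by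
  obtain ⟨k, rfl | rfl⟩ := n.eq_nat_or_neg
  · rw [iter_natCast]
    refine ⟨fun h => ⟨0, k, x, by simp, mem_iterNat_zero.2 rfl, h⟩, ?_⟩
    rintro ⟨a, b, u, hk, hx, hy⟩
    obtain rfl : b = a + k := by omega
    obtain ⟨x', hx', hy⟩ := mem_iterNat_add.1 hy
    rwa [Part.mem_unique hx hx']
  · rw [iter_neg_natCast, mem_iterNat_symm]
    refine ⟨fun h => ⟨k, 0, y, by simp, h, mem_iterNat_zero.2 rfl⟩, ?_⟩
    rintro ⟨a, b, u, hk, hx, hy⟩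
    obtain rfl : a = b + k := by omega
    obtain ⟨y', hy', hx⟩ := mem_iterNat_add.1 hx
    rwa [Part.mem_unique hy hy']

theorem mem_iter_refl (x : X) : x ∈ P.iter 0 x := mem_iterNat_zero (P := P).2 rfl

theorem mem_iter_neg {n : ℤ} {x y : X} (h : y ∈ P.iter n x) : x ∈ P.iter (-n) y := by
  obtain ⟨a, b, u, rfl, hx, hy⟩ := mem_iter.1 h
  exact mem_iter.2 ⟨b, a, u, by ring, hy, hx⟩

theorem mem_iter_neg_iff {n : ℤ} {x y : X} : x ∈ P.iter (-n) y ↔ y ∈ P.iter n x :=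
  ⟨fun h => by simpa using mem_iter_neg h, mem_iter_neg⟩

theorem mem_iter_add {m n : ℤ} {x y z : X} (hy : y ∈ P.iter m x) (hz : z ∈ P.iter n y) :
    z ∈ P.iter (m + n) x := by
  obtain ⟨a, b, u, rfl, hx, hy⟩ := mem_iter.1 hy
  obtain ⟨c, d, w, rfl, hy', hz⟩ := mem_iter.1 hz
  rcases le_total b c with h | h
  · refine mem_iter.2 ⟨c - b + a, d, w, by omega, ?_, hz⟩
    exact mem_iterNat_add.2 ⟨u, mem_iterNat_sub h hy hy', hx⟩
  · refine mem_iter.2 ⟨a, b - c + d, u, by omega, hx, ?_⟩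
    exact mem_iterNat_add.2 ⟨w, mem_iterNat_sub h hy' hy, hz⟩

theorem Aperiodic.iter_unique (hP : P.Aperiodic) {m n : ℤ} {x y : X} (hm : y ∈ P.iter m x)
    (hn : y ∈ P.iter n x) : m = n := by
  have h := mem_iter_add hm (mem_iter_neg hn)
  have h' := mem_iter_add hn (mem_iter_neg hm)
  rcases lt_trichotomy m n with hlt | rfl | hlt
  · obtain ⟨k, hk⟩ := Int.le.dest hlt.le
    rw [show n + -m = (k : ℤ) by omega, iter_natCast] at h'
    exact absurd h' (hP k x (by omega))
  · rfl
  · obtain ⟨k, hk⟩ := Int.le.dest hlt.le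
    rw [show m + -n = (k : ℤ) by omega, iter_natCast] at h
    exact absurd h (hP k x (by omega))

theorem isOpen_preimage_iterNat (n : ℕ) {V : Set X} (hV : IsOpen V) :
    IsOpen {x | ∃ y ∈ V, y ∈ P.iterNat n x} := by
  induction n generalizing V with
  | zero => simpa [mem_iterNat_zero] using hV
  | succ n ih =>
    convert ih (isOpen_preimage_map (P := P) hV) using 1
    ext x
    simp only [mem_iterNat_succ, mem_ofPred_eq]
    tauto

theorem isOpen_preimage_iter (n : ℤ) {V : Set X} (hV : IsOpen V) :
    IsOpen {x | ∃ y ∈ V, y ∈ P.iter n x} := by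
  obtain ⟨k, rfl | rfl⟩ := n.eq_nat_or_neg
  · exact isOpen_preimage_iterNat k hV
  · rw [iter_neg_natCast]
    exact isOpen_preimage_iterNat k hV

theorem equivalence_orbitRel (P : PartialDynamicalSystem X) :
    Equivalence fun x y : X => (x, y) ∈ P.orbitRel where
  refl x := ⟨0, mem_iter_refl x⟩
  symm := fun ⟨n, h⟩ => ⟨-n, mem_iter_neg h⟩
  trans := fun ⟨m, h⟩ ⟨n, h'⟩ => ⟨m + n, mem_iter_add h h'⟩

end Iterates

/-! ### The backward map outside a clopen neighbourhood of `Xmin` -/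

section Back

variable {X : Type u} [TopologicalSpace X] (P : PartialDynamicalSystem X) (U : Set X)

open Classical in
/-- The total map that is `φ⁻¹` off `U` and the identity on `U`. It is meant for
`U ⊇ Xmin`; on `Xmin` it is the identity in any case. -/
noncomputable def back (x : X) : X :=
  if h : x ∈ Uᶜ ∩ P.Xminᶜ then (P.φ.symm ⟨x, h.2⟩ : X) else x

/-- The points that `φ` maps into `U`, together with those where `φ` is undefined. -/
def top : Set X := {x | ∀ y ∈ P.map x, y ∈ U}

/-- The total map that is `φ` off `P.top U` and the identity on `P.top U`. It is inverse to
`P.back U : Uᶜ → (P.top U)ᶜ`. -/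
noncomputable def fwd (x : X) : X := P.symm.back (P.top U) x

/-- The number of backward steps from a point to its first visit to `U`
(the junk value `0` if there is none). -/
noncomputable def depth (x : X) : ℕ := sInf {n | (P.back U)^[n] x ∈ U}

/-- The last point of `U` on the way to `x`, that is, the bottom of the tower over `U` in which
`x` lies. -/
noncomputable def base (x : X) : X := (P.back U)^[P.depth U x] x

/-- There is no nonempty closed set `K` with `φ(K) = K`; such a set misses `Xmax` and `Xmin`. -/
def NoInvariantSet : Prop :=
  ∀ K : Set X, IsClosed K → (∀ x ∈ K, ∃ y ∈ K, y ∈ P.map x) → (∀ y ∈ K, ∃ x ∈ K, y ∈ P.map x) →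
    K = ∅

variable {P U}

theorem NoInvariantSet.symm (h : P.NoInvariantSet) : P.symm.NoInvariantSet := fun K hK h1 h2 =>
  h K hK (fun x hx => (h2 x hx).imp fun _ hy => ⟨hy.1, mem_map_symm.1 hy.2⟩)
    (fun x hx => (h1 x hx).imp fun _ hy => ⟨hy.1, mem_map_symm.1 hy.2⟩)

theorem noInvariantSet_symm_iff : P.symm.NoInvariantSet ↔ P.NoInvariantSet :=
  ⟨fun h => h.symm, fun h => h.symm⟩

theorem back_of_mem {x : X} (h : x ∈ U) : P.back U x = x := dif_neg fun h' => h'.1 h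

theorem back_of_notMem {x : X} (h : x ∉ U) (h' : x ∉ P.Xmin) :
    P.back U x = (P.φ.symm ⟨x, h'⟩ : X) := dif_pos ⟨h, h'⟩

theorem mem_map_back (hU : P.Xmin ⊆ U) {x : X} (h : x ∉ U) : x ∈ P.map (P.back U x) := by
  have h' : x ∉ P.Xmin := fun h' => h (hU h')
  rw [back_of_notMem h h', ← mem_map_symm]
  exact ⟨h', rfl⟩

theorem back_eq {x y : X} (hxy : y ∈ P.map x) (hy : y ∉ U) : P.back U y = x := by
  have h' := notMem_min_of_mem_map hxy
  rw [back_of_notMem hy h']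
  exact mem_map_injective (mem_map_symm.1 ⟨h', rfl⟩) hxy

theorem continuous_back (hU : IsClopen U) (hmin : P.Xmin ⊆ U) : Continuous (P.back U) := by
  have h1 : ContinuousOn (P.back U) U := continuousOn_id.congr fun x hx => back_of_mem hx
  have h2 : ContinuousOn (P.back U) Uᶜ := by
    rw [continuousOn_iff_continuous_domRestrict]
    have : Uᶜ.domRestrict (P.back U) = fun x : ↥Uᶜ =>
        (P.φ.symm ⟨x.1, fun h => x.2 (hmin h)⟩ : X) :=
      funext fun x => back_of_notMem x.2 fun h => x.2 (hmin h)
    rw [this]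
    exact continuous_subtype_val.comp
      (P.φ.symm.continuous.comp (continuous_subtype_val.subtype_mk _))
  rw [continuous_iff_continuousAt]
  intro x
  by_cases hx : x ∈ U
  · exact h1.continuousAt (hU.isOpen.mem_nhds hx)
  · exact h2.continuousAt (hU.compl.isOpen.mem_nhds hx)

theorem max_subset_top : P.Xmax ⊆ P.top U := fun _ hx _ hy => absurd hx (notMem_max_of_mem_map hy)

theorem mem_map_fwd {x : X} (h : x ∉ P.top U) : P.fwd U x ∈ P.map x :=
  mem_map_symm.1 (mem_map_back (P := P.symm) max_subset_top h)

theorem fwd_of_mem_top {x : X} (h : x ∈ P.top U) : P.fwd U x = x := back_of_mem h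

theorem fwd_eq {x y : X} (hxy : y ∈ P.map x) (hx : x ∉ P.top U) : P.fwd U x = y :=
  mem_map_unique (mem_map_fwd hx) hxy

theorem fwd_notMem {x : X} (h : x ∉ P.top U) : P.fwd U x ∉ U := by
  intro h'
  exact h fun y hy => mem_map_unique (mem_map_fwd h) hy ▸ h'

theorem notMem_top {x y : X} (hxy : y ∈ P.map x) (hy : y ∉ U) : x ∉ P.top U :=
  fun h => hy (h y hxy)

theorem fwd_back (hmin : P.Xmin ⊆ U) {x : X} (h : x ∉ U) : P.fwd U (P.back U x) = x :=
  fwd_eq (mem_map_back hmin h) (notMem_top (mem_map_back hmin h) h)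

theorem isClopen_top [CompactSpace X] [T2Space X] (hU : IsClopen U) (hmin : P.Xmin ⊆ U) :
    IsClopen (P.top U) := by
  have h1 : (P.top U)ᶜ = {x | ∃ y ∈ Uᶜ, y ∈ P.map x} := by
    ext x
    simp [top, and_comm]
  have h2 : (P.top U)ᶜ = P.back U '' Uᶜ := by
    rw [h1]
    ext x
    constructor
    · rintro ⟨y, hy, hxy⟩
      exact ⟨y, hy, back_eq hxy hy⟩
    · rintro ⟨y, hy, rfl⟩
      exact ⟨y, hy, mem_map_back hmin hy⟩
  rw [← isClopen_compl_iff]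
  refine ⟨?_, h1 ▸ isOpen_preimage_map hU.compl.isOpen⟩
  rw [h2]
  exact (hU.compl.isClosed.isCompact.image (continuous_back hU hmin)).isClosed

theorem continuous_fwd [CompactSpace X] [T2Space X] (hU : IsClopen U) (hmin : P.Xmin ⊆ U) :
    Continuous (P.fwd U) := continuous_back (P := P.symm) (isClopen_top hU hmin) max_subset_top

/-- The union of the forward images of `U` consists of the points whose backward orbit
meets `U`. -/
theorem mem_iUnion_image_iff (hmin : P.Xmin ⊆ U) {x : X} :
    x ∈ ⋃ n : ℕ, (P.iter (n : ℤ)).image U ↔ ∃ n, (P.back U)^[n] x ∈ U := by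
  have key : x ∈ ⋃ n : ℕ, (P.iter (n : ℤ)).image U ↔ ∃ n : ℕ, ∃ y ∈ U, x ∈ P.iterNat n y := by
    rw [mem_iUnion]; rfl
  rw [key]
  clear key
  constructor
  · rintro ⟨n, y, hy, hx⟩
    induction n generalizing x with
    | zero => exact ⟨0, by rwa [mem_iterNat_zero.1 hx]⟩
    | succ n ih =>
      obtain ⟨z, hz, hzx⟩ := mem_iterNat_succ.1 hx
      by_cases hxU : x ∈ U
      · exact ⟨0, hxU⟩
      · obtain ⟨m, hm⟩ := ih hz
        exact ⟨m + 1, by rwa [Function.iterate_succ_apply, back_eq hzx hxU]⟩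
  · rintro ⟨n, hn⟩
    induction n generalizing x with
    | zero => exact ⟨0, x, hn, mem_iterNat_zero.2 rfl⟩
    | succ n ih =>
      by_cases hxU : x ∈ U
      · exact ⟨0, x, hxU, mem_iterNat_zero.2 rfl⟩
      · rw [Function.iterate_succ_apply] at hn
        obtain ⟨m, y, hy, hx⟩ := ih hn
        exact ⟨m + 1, y, hy, mem_iterNat_succ.2 ⟨_, hx, mem_map_back hmin hxU⟩⟩

/-- Otherwise the points whose backward orbit never meets `U` form a nonempty closed set `A` that
the continuous map `P.back U` sends injectively into itself, and the intersection of the images of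
`A` under its iterates is invariant. -/
theorem NoInvariantSet.exists_back_mem [CompactSpace X] [T2Space X] (hP : P.NoInvariantSet)
    (hU : IsClopen U) (hmin : P.Xmin ⊆ U) (x : X) : ∃ n, (P.back U)^[n] x ∈ U := by
  by_contra! hx
  set f := P.back U with hf
  have hfc : Continuous f := continuous_back hU hmin
  let A : Set X := {x | ∀ n, f^[n] x ∉ U}
  have hA : IsClosed A := by
    have : A = ⋂ n, (f^[n]) ⁻¹' Uᶜ := by ext; simp [A]
    rw [this]
    exact isClosed_iInter fun n => hU.compl.isClosed.preimage (hfc.iterate n)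
  have hAU : ∀ y ∈ A, y ∉ U := fun y hy => hy 0
  have hfA : ∀ y ∈ A, f y ∈ A := fun y hy n => hy (n + 1)
  have hfnA : ∀ n, f^[n] '' A ⊆ A := by
    intro n
    induction n with
    | zero => simp
    | succ n ih =>
      rw [Function.iterate_succ', image_comp]
      rintro _ ⟨y, hy, rfl⟩
      exact hfA _ (ih hy)
  have hinj : ∀ y ∈ A, ∀ z ∈ A, f y = f z → y = z := fun y hy z hz h =>
    mem_map_unique (mem_map_back hmin (hAU y hy)) (by
      have := mem_map_back (P := P) hmin (hAU z hz)
      rwa [← hf, ← h] at this)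
  have hclosed : ∀ n, IsClosed (f^[n] '' A) := fun n =>
    (hA.isCompact.image (hfc.iterate n)).isClosed
  let K : Set X := ⋂ n, f^[n] '' A
  have hKA : K ⊆ A := fun y hy => hfnA 0 (mem_iInter.1 hy 0)
  have hK : K.Nonempty := by
    refine IsCompact.nonempty_iInter_of_sequence_nonempty_isCompact_isClosed _ (fun n => ?_)
      (fun n => ⟨_, mem_image_of_mem _ (show x ∈ A from hx)⟩) ?_ hclosed
    · rw [Function.iterate_succ, image_comp]
      exact image_mono (by rintro _ ⟨y, hy, rfl⟩; exact hfA y hy)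
    · exact (hclosed 0).isCompact
  refine hK.ne_empty (hP K (isClosed_iInter hclosed) (fun y hy => ?_) fun y hy => ?_)
  · obtain ⟨z, hz, hzy⟩ := mem_iInter.1 hy 1
    refine ⟨z, mem_iInter.2 fun n => ?_, ?_⟩
    · obtain ⟨w, hw, hwy⟩ := mem_iInter.1 hy (n + 1)
      refine ⟨w, hw, hinj _ (hfnA n ⟨w, hw, rfl⟩) _ hz ?_⟩
      rw [← Function.iterate_succ_apply' f, hwy, ← hzy]
      rfl
    · have := mem_map_back (P := P) hmin (hAU z hz)
      rw [← hzy]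
      exact this
  · refine ⟨f y, mem_iInter.2 fun n => ?_, mem_map_back hmin (hAU y (hKA hy))⟩
    obtain ⟨w, hw, rfl⟩ := mem_iInter.1 hy n
    exact ⟨f w, hfA w hw, by rw [← Function.iterate_succ_apply, Function.iterate_succ_apply']⟩

/-- Forward images of clopen neighbourhoods of `Xmin` exhaust the space if and only if there is
no nonempty closed invariant set. -/
theorem noInvariantSet_iff [CompactSpace X] [T2Space X] [TotallyDisconnectedSpace X] :
    P.NoInvariantSet ↔ ∀ U : Set X, IsClopen U → P.Xmin ⊆ U →
      (⋃ n : ℕ, (P.iter (n : ℤ)).image U) = univ := by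
  constructor
  · intro h U hU hmin
    exact eq_univ_of_forall fun x => (mem_iUnion_image_iff hmin).2 (h.exists_back_mem hU hmin x)
  · intro h K hK _ h2
    by_contra hne
    obtain ⟨x, hx⟩ := nonempty_iff_ne_empty.2 hne
    have hdisj : P.Xmin ⊆ Kᶜ := fun y hy hyK => by
      obtain ⟨z, -, hz⟩ := h2 y hyK
      exact notMem_min_of_mem_map hz hy
    obtain ⟨U, hU, hmin, hUK⟩ :=
      exists_clopen_of_closed_subset_open P.isClosed_min hK.isOpen_compl hdisj
    obtain ⟨n, hn⟩ := (mem_iUnion_image_iff hmin).1 ((h U hU hmin).symm ▸ mem_univ x)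
    have hiter : (P.back U)^[n] x ∈ K := by
      have hmaps : MapsTo (P.back U) K K := fun y hy => by
        obtain ⟨z, hz, hzy⟩ := h2 y hy
        rwa [back_eq hzy fun hyU => hUK hyU hy]
      exact hmaps.iterate n hx
    exact hUK hn hiter

end Back

end PartialDynamicalSystem

/-! ### Towers over a clopen neighbourhood of `Xmin` -/

namespace PartialDynamicalSystem

section Towers

variable {X : Type u} [TopologicalSpace X] {P : PartialDynamicalSystem X} {U U' : Set X}

theorem depth_of_mem {x : X} (h : x ∈ U) : P.depth U x = 0 :=
  Nat.sInf_eq_zero.2 (Or.inl h)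

theorem base_of_mem {x : X} (h : x ∈ U) : P.base U x = x := by
  rw [base, depth_of_mem h, Function.iterate_zero_apply]

theorem iterate_depth_mem (hr : ∀ x, ∃ n, (P.back U)^[n] x ∈ U) (x : X) :
    (P.back U)^[P.depth U x] x ∈ U := Nat.sInf_mem (s := {n | (P.back U)^[n] x ∈ U}) (hr x)

theorem base_mem (hr : ∀ x, ∃ n, (P.back U)^[n] x ∈ U) (x : X) : P.base U x ∈ U :=
  iterate_depth_mem hr x

theorem base_base (hr : ∀ x, ∃ n, (P.back U)^[n] x ∈ U) (x : X) :
    P.base U (P.base U x) = P.base U x := base_of_mem (base_mem hr x)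

theorem depth_of_notMem (hr : ∀ x, ∃ n, (P.back U)^[n] x ∈ U) {x : X} (h : x ∉ U) :
    P.depth U x = P.depth U (P.back U x) + 1 := by
  have hpos : P.depth U x ≠ 0 := fun h0 => h (by simpa [h0] using iterate_depth_mem hr x)
  obtain ⟨k, hk⟩ := Nat.exists_eq_succ_of_ne_zero hpos
  refine le_antisymm (Nat.sInf_le (iterate_depth_mem hr (P.back U x))) ?_
  rw [hk]
  refine Nat.succ_le_succ (Nat.sInf_le ?_)
  have := iterate_depth_mem hr x
  rwa [hk] at this

theorem base_of_notMem (hr : ∀ x, ∃ n, (P.back U)^[n] x ∈ U) {x : X} (h : x ∉ U) :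
    P.base U x = P.base U (P.back U x) := by
  rw [base, depth_of_notMem hr h, Function.iterate_succ_apply, base]

theorem depth_of_mem_map (hr : ∀ x, ∃ n, (P.back U)^[n] x ∈ U) {x y : X} (hxy : y ∈ P.map x)
    (hy : y ∉ U) : P.depth U y = P.depth U x + 1 := by
  rw [depth_of_notMem hr hy, back_eq hxy hy]

theorem base_of_mem_map (hr : ∀ x, ∃ n, (P.back U)^[n] x ∈ U) {x y : X} (hxy : y ∈ P.map x)
    (hy : y ∉ U) : P.base U y = P.base U x := by
  rw [base_of_notMem hr hy, back_eq hxy hy]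

/-- Induction along a tower, upwards from its bottom. -/
theorem tower_induction (hr : ∀ x, ∃ n, (P.back U)^[n] x ∈ U) {p : X → Prop}
    (h0 : ∀ x ∈ U, p x) (h1 : ∀ x ∉ U, p (P.back U x) → p x) (x : X) : p x := by
  induction hn : P.depth U x generalizing x with
  | zero =>
    refine h0 x ?_
    simpa [hn] using iterate_depth_mem hr x
  | succ n ih =>
    have hx : x ∉ U := fun h => by simp [depth_of_mem h] at hn
    refine h1 x hx (ih _ ?_)
    rw [depth_of_notMem hr hx] at hn
    omega

/-- A point is reached from the bottom of its tower in `depth` steps, none of which starts at a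
top point. -/
theorem fwd_iterate_base (hmin : P.Xmin ⊆ U) (hr : ∀ x, ∃ n, (P.back U)^[n] x ∈ U) (x : X) :
    (P.fwd U)^[P.depth U x] (P.base U x) = x ∧
      ∀ i < P.depth U x, (P.fwd U)^[i] (P.base U x) ∉ P.top U := by
  induction x using tower_induction hr with
  | h0 x hx => simp [depth_of_mem hx, base_of_mem hx]
  | h1 x hx ih =>
    rw [depth_of_notMem hr hx, base_of_notMem hr hx]
    refine ⟨by rw [Function.iterate_succ_apply', ih.1, fwd_back hmin hx], fun i hi => ?_⟩
    rcases Nat.lt_succ_iff_lt_or_eq.1 hi with hi | rfl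
    · exact ih.2 i hi
    · rw [ih.1]
      exact notMem_top (mem_map_back hmin hx) hx

theorem eq_of_base_eq (hmin : P.Xmin ⊆ U) (hr : ∀ x, ∃ n, (P.back U)^[n] x ∈ U) {x y : X}
    (hb : P.base U x = P.base U y) (hd : P.depth U x = P.depth U y) : x = y := by
  rw [← (fwd_iterate_base hmin hr x).1, ← (fwd_iterate_base hmin hr y).1, hb, hd]

theorem depth_fwd_iterate (hr : ∀ x, ∃ n, (P.back U)^[n] x ∈ U) {u : X} (hu : u ∈ U) {n : ℕ}
    (h : ∀ i < n, (P.fwd U)^[i] u ∉ P.top U) :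
    P.depth U ((P.fwd U)^[n] u) = n ∧ P.base U ((P.fwd U)^[n] u) = u ∧
      (P.fwd U)^[n] u ∈ P.iterNat n u := by
  induction n with
  | zero => simp [depth_of_mem hu, base_of_mem hu, mem_iterNat_zero]
  | succ n ih =>
    obtain ⟨h1, h2, h3⟩ := ih fun i hi => h i (hi.trans n.lt_succ_self)
    have hn := h n n.lt_succ_self
    rw [Function.iterate_succ_apply']
    exact ⟨by rw [depth_of_mem_map hr (mem_map_fwd hn) (fwd_notMem hn), h1],
      by rw [base_of_mem_map hr (mem_map_fwd hn) (fwd_notMem hn), h2],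
      mem_iterNat_succ.2 ⟨_, h3, mem_map_fwd hn⟩⟩

theorem mem_iterNat_base (hmin : P.Xmin ⊆ U) (hr : ∀ x, ∃ n, (P.back U)^[n] x ∈ U) (x : X) :
    x ∈ P.iterNat (P.depth U x) (P.base U x) := by
  obtain ⟨h1, h2⟩ := fwd_iterate_base hmin hr x
  simpa only [h1] using (depth_fwd_iterate hr (base_mem hr x) h2).2.2

theorem isClopen_depth (hU : IsClopen U) (hmin : P.Xmin ⊆ U)
    (hr : ∀ x, ∃ n, (P.back U)^[n] x ∈ U) (n : ℕ) : IsClopen {x | P.depth U x = n} := by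
  have hc : ∀ k, IsClopen ((P.back U)^[k] ⁻¹' U) := fun k =>
    hU.preimage ((continuous_back hU hmin).iterate k)
  have : {x | P.depth U x = n} =
      (P.back U)^[n] ⁻¹' U ∩ ⋂ i ∈ Iio n, ((P.back U)^[i] ⁻¹' U)ᶜ := by
    ext x
    simp only [mem_inter_iff, mem_iInter, mem_compl_iff, mem_preimage, mem_Iio]
    constructor
    · rintro rfl
      exact ⟨iterate_depth_mem hr x, fun i hi => Nat.notMem_of_lt_sInf hi⟩
    · rintro ⟨h1, h2⟩
      refine le_antisymm (Nat.sInf_le h1) (not_lt.1 fun hlt => h2 _ hlt (iterate_depth_mem hr x))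
  rw [this]
  exact (hc n).inter ((finite_Iio n).isClopen_biInter fun i _ => (hc i).compl)

theorem continuous_depth (hU : IsClopen U) (hmin : P.Xmin ⊆ U)
    (hr : ∀ x, ∃ n, (P.back U)^[n] x ∈ U) : Continuous (P.depth U) :=
  continuous_discrete_rng.2 fun n => (isClopen_depth hU hmin hr n).isOpen

theorem continuous_base (hU : IsClopen U) (hmin : P.Xmin ⊆ U)
    (hr : ∀ x, ∃ n, (P.back U)^[n] x ∈ U) : Continuous (P.base U) := by
  rw [continuous_iff_continuousAt]
  intro x
  refine (((continuous_back hU hmin).iterate (P.depth U x)).continuousAt (x := x)).congr ?_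
  filter_upwards [(isClopen_depth hU hmin hr (P.depth U x)).isOpen.mem_nhds rfl] with y hy
  rw [base, show P.depth U y = P.depth U x from hy]

theorem exists_depth_le [CompactSpace X] (hU : IsClopen U) (hmin : P.Xmin ⊆ U)
    (hr : ∀ x, ∃ n, (P.back U)^[n] x ∈ U) : ∃ N, ∀ x, P.depth U x ≤ N := by
  obtain ⟨N, hN⟩ := (isCompact_range (continuous_depth hU hmin hr)).bddAbove
  exact ⟨N, fun x => hN (mem_range_self x)⟩

/-- Every tower has a top, since the depths are bounded. -/
theorem exists_fwd_iterate_mem_top [CompactSpace X] (hU : IsClopen U) (hmin : P.Xmin ⊆ U)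
    (hr : ∀ x, ∃ n, (P.back U)^[n] x ∈ U) {u : X} (hu : u ∈ U) :
    ∃ n, (P.fwd U)^[n] u ∈ P.top U := by
  obtain ⟨N, hN⟩ := exists_depth_le hU hmin hr
  by_contra! h
  have := (depth_fwd_iterate hr hu (n := N + 1) fun i _ => h i).1
  have := hN ((P.fwd U)^[N + 1] u)
  omega

/-- The tower over a smaller base `U'` in which `x` lies contains the tower over `U` in which `x`
lies as a segment. -/
theorem base_base_of_subset (hsub : U' ⊆ U) (hr : ∀ x, ∃ n, (P.back U)^[n] x ∈ U)
    (hr' : ∀ x, ∃ n, (P.back U')^[n] x ∈ U') (hmin : P.Xmin ⊆ U) (x : X) :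
    P.base U' (P.base U x) = P.base U' x ∧
      P.depth U' x = P.depth U' (P.base U x) + P.depth U x := by
  induction x using tower_induction hr with
  | h0 x hx => simp [base_of_mem hx, depth_of_mem hx]
  | h1 x hx ih =>
    have h := mem_map_back (P := P) hmin hx
    have hx' : x ∉ U' := fun h => hx (hsub h)
    rw [base_of_notMem hr hx, depth_of_notMem hr hx, base_of_mem_map hr' h hx',
      depth_of_mem_map hr' h hx', ih.1, ih.2]
    exact ⟨rfl, add_assoc _ _ _⟩

/-- In a tower over `U' ⊆ U`, the last point of `U` before `x` is `P.base U x`. -/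
theorem depth_le_depth_base (hsub : U' ⊆ U) (hmin' : P.Xmin ⊆ U')
    (hr : ∀ x, ∃ n, (P.back U)^[n] x ∈ U) (hr' : ∀ x, ∃ n, (P.back U')^[n] x ∈ U') {x z : X}
    (hz : z ∈ U) (hb : P.base U' z = P.base U' x) (hd : P.depth U' z ≤ P.depth U' x) :
    P.depth U' z ≤ P.depth U' (P.base U x) := by
  induction x using tower_induction hr with
  | h0 x hx => rwa [base_of_mem hx]
  | h1 x hx ih =>
    have h := mem_map_back (P := P) (hmin'.trans hsub) hx
    have hx' : x ∉ U' := fun h => hx (hsub h)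
    rw [base_of_notMem hr hx]
    rcases hd.lt_or_eq with hlt | heq
    · rw [depth_of_mem_map hr' h hx'] at hlt
      exact ih (hb.trans (base_of_mem_map hr' h hx')) (by omega)
    · exact absurd (eq_of_base_eq hmin' hr' hb heq ▸ hz) hx

end Towers

/-! ### A decreasing sequence of clopen neighbourhoods of `Xmin` -/

section Neighbourhoods

variable {X : Type u} [TopologicalSpace X] (P : PartialDynamicalSystem X) (C : ℕ → Set X)

/-- The intersection of those of the first `n` members of the sequence `C` of sets that
contain `Xmin`. -/
def nbhd (n : ℕ) : Set X := {x | ∀ i < n, P.Xmin ⊆ C i → x ∈ C i}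

theorem nbhd_zero : P.nbhd C 0 = univ := by simp [nbhd, ofPred_true]

theorem min_subset_nbhd (n : ℕ) : P.Xmin ⊆ P.nbhd C n := fun _ hx _ _ h => h hx

theorem nbhd_anti : Antitone (P.nbhd C) := fun _ _ hmn _ hx i hi => hx i (hi.trans_le hmn)

variable {P C}

theorem isClopen_nbhd (hC : ∀ n, IsClopen (C n)) (n : ℕ) : IsClopen (P.nbhd C n) := by
  have : P.nbhd C n = ⋂ i ∈ {i | i < n ∧ P.Xmin ⊆ C i}, C i := by
    ext x
    simp [nbhd]
  rw [this]
  exact ((finite_Iio n).subset fun i hi => hi.1).isClopen_biInter fun i _ => hC i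

theorem exists_notMem_nbhd [CompactSpace X] [T2Space X] [TotallyDisconnectedSpace X]
    (hC : ∀ U : Set X, IsClopen U → ∃ n, C n = U) {x : X} (hx : x ∉ P.Xmin) :
    ∃ n, ∀ m ≥ n, x ∉ P.nbhd C m := by
  obtain ⟨V, hV, hxV, hVmin⟩ := compact_exists_isClopen_in_isOpen P.isClosed_min.isOpen_compl hx
  obtain ⟨n, hn⟩ := hC Vᶜ hV.compl
  refine ⟨n + 1, fun m hm h => ?_⟩
  have := h n (by omega) (by rw [hn]; exact subset_compl_comm.1 hVmin)
  rw [hn] at this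
  exact this hxV

/-- Finitely many steps stay in a single tower over a sufficiently small base. -/
theorem exists_forall_base_eq [CompactSpace X] [T2Space X] [TotallyDisconnectedSpace X]
    (hC : ∀ U : Set X, IsClopen U → ∃ n, C n = U)
    (hr : ∀ n x, ∃ k, (P.back (P.nbhd C n))^[k] x ∈ P.nbhd C n) {k : ℕ} {x y : X}
    (h : y ∈ P.iterNat k x) : ∃ n, ∀ m ≥ n, P.base (P.nbhd C m) y = P.base (P.nbhd C m) x ∧
      P.depth (P.nbhd C m) y = P.depth (P.nbhd C m) x + k := by
  induction k generalizing y with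
  | zero => exact ⟨0, fun m _ => by simp [mem_iterNat_zero.1 h]⟩
  | succ k ih =>
    obtain ⟨z, hz, hzy⟩ := mem_iterNat_succ.1 h
    obtain ⟨n, hn⟩ := ih hz
    obtain ⟨n', hn'⟩ := exists_notMem_nbhd hC (notMem_min_of_mem_map hzy)
    refine ⟨max n n', fun m hm => ?_⟩
    have h1 := hn m (le_of_max_le_left hm)
    have h2 := hn' m (le_of_max_le_right hm)
    rw [base_of_mem_map (hr m) hzy h2, depth_of_mem_map (hr m) hzy h2, h1.1, h1.2]
    exact ⟨rfl, add_assoc _ _ _⟩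

/-- On a compact totally disconnected metric space the clopen sets can be enumerated. -/
theorem exists_clopen_enumeration (X : Type u) [MetricSpace X] [CompactSpace X]
    [TotallyDisconnectedSpace X] :
    ∃ C : ℕ → Set X, (∀ n, IsClopen (C n)) ∧ ∀ U, IsClopen U → ∃ n, C n = U := by
  have : Countable (TopologicalSpace.Clopens X) :=
    TopologicalSpace.Clopens.countable_iff_secondCountable.2 inferInstance
  obtain ⟨f, hf⟩ := exists_surjective_nat (TopologicalSpace.Clopens X)
  refine ⟨fun n => f n, fun n => (f n).isClopen, fun U hU => ?_⟩
  obtain ⟨n, hn⟩ := hf ⟨U, hU⟩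
  exact ⟨n, by simp [hn]⟩

end Neighbourhoods

end PartialDynamicalSystem

/-! ### The orbit relation as an AF groupoid -/

namespace PartialDynamicalSystem

section OrbitTopology

variable {X : Type u} [TopologicalSpace X] {P : PartialDynamicalSystem X}

theorem isOpen_graph (n : ℤ) {U : Set X} (hU : IsOpen U) :
    IsOpen[P.orbitTopology] {p : ↥P.orbitRel | p.1.1 ∈ U ∧ p.1.2 ∈ P.iter n p.1.1} :=
  TopologicalSpace.isOpen_generateFrom_of_mem ⟨n, U, hU, rfl⟩

/-- Without periodic points distinct `φⁿ` have disjoint graphs, so the graphs of the restrictions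
of `φⁿ` to the neighbourhoods of `x` form a neighbourhood basis at `(x, φⁿ(x))`. -/
theorem Aperiodic.exists_graph_subset (hP : P.Aperiodic) {W : Set ↥P.orbitRel}
    (hW : IsOpen[P.orbitTopology] W) {p : ↥P.orbitRel} (hp : p ∈ W) {n : ℤ}
    (hn : p.1.2 ∈ P.iter n p.1.1) :
    ∃ U : Set X, IsOpen U ∧ p.1.1 ∈ U ∧
      ∀ q : ↥P.orbitRel, q.1.1 ∈ U → q.1.2 ∈ P.iter n q.1.1 → q ∈ W := by
  induction hW with
  | basic W hW =>
    obtain ⟨m, U, hU, rfl⟩ := hW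
    obtain rfl := hP.iter_unique hn hp.2
    exact ⟨U, hU, hp.1, fun q h1 h2 => ⟨h1, h2⟩⟩
  | univ => exact ⟨univ, isOpen_univ, mem_univ _, fun _ _ _ => mem_univ _⟩
  | inter W W' _ _ ih ih' =>
    obtain ⟨U, hU, hpU, h⟩ := ih hp.1
    obtain ⟨U', hU', hpU', h'⟩ := ih' hp.2
    exact ⟨U ∩ U', hU.inter hU', ⟨hpU, hpU'⟩, fun q h1 h2 => ⟨h q h1.1 h2, h' q h1.2 h2⟩⟩
  | sUnion S _ ih =>
    obtain ⟨W, hWS, hpW⟩ := hp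
    obtain ⟨U, hU, hpU, h⟩ := ih W hWS hpW
    exact ⟨U, hU, hpU, fun q h1 h2 => ⟨W, hWS, h q h1 h2⟩⟩

theorem continuous_orbit_fst : Continuous[P.orbitTopology, _] fun p : ↥P.orbitRel => p.1.1 := by
  let := P.orbitTopology
  refine continuous_def.2 fun V hV => ?_
  have : (fun p : ↥P.orbitRel => p.1.1) ⁻¹' V =
      ⋃ n : ℤ, {p : ↥P.orbitRel | p.1.1 ∈ V ∧ p.1.2 ∈ P.iter n p.1.1} := by
    ext p
    obtain ⟨n, hn⟩ := p.2
    simp only [mem_preimage, mem_iUnion]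
    exact ⟨fun h => ⟨n, h, hn⟩, fun ⟨_, h, _⟩ => h⟩
  rw [this]
  exact isOpen_iUnion fun n => isOpen_graph n hV

theorem continuous_orbit_inv : Continuous[P.orbitTopology, P.orbitTopology]
    fun p : ↥P.orbitRel => (⟨(p.1.2, p.1.1), P.equivalence_orbitRel.symm p.2⟩ : ↥P.orbitRel) := by
  let := P.orbitTopology
  refine continuous_generateFrom_iff.2 ?_
  rintro _ ⟨n, U, hU, rfl⟩
  convert isOpen_graph (P := P) (-n) (isOpen_preimage_iter (P := P) (-n) hU) using 1
  ext p
  constructor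
  · rintro ⟨h1, h2⟩
    exact ⟨⟨_, h1, mem_iter_neg h2⟩, mem_iter_neg h2⟩
  · rintro ⟨⟨y, hy, hy'⟩, h2⟩
    obtain rfl := Part.mem_unique h2 hy'
    exact ⟨hy, mem_iter_neg_iff.1 h2⟩

theorem continuous_orbit_snd : Continuous[P.orbitTopology, _] fun p : ↥P.orbitRel => p.1.2 := by
  let := P.orbitTopology
  exact continuous_orbit_fst.comp continuous_orbit_inv

theorem t2Space_orbitRel [T2Space X] : @T2Space ↥P.orbitRel P.orbitTopology := by
  let := P.orbitTopology
  exact T2Space.of_injective_continuous (f := fun p : ↥P.orbitRel => (p.1.1, p.1.2))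
    (fun p q h => Subtype.ext h) (continuous_orbit_fst.prodMk continuous_orbit_snd)

theorem Aperiodic.isEtaleRelation [T2Space X] (hP : P.Aperiodic) :
    IsEtaleRelation P.orbitRel P.orbitTopology := by
  let := P.orbitTopology
  refine ⟨P.equivalence_orbitRel, t2Space_orbitRel, continuous_orbit_inv, ?_, ?_⟩
  · refine continuous_generateFrom_iff.2 ?_
    rintro _ ⟨n, U, hU, rfl⟩
    refine isOpen_iff_mem_nhds.2 ?_
    rintro ⟨⟨p, q⟩, hpq⟩ ⟨h1, h2⟩
    obtain ⟨a, ha⟩ := p.2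
    obtain ⟨b, hb⟩ := q.2
    have hb' : q.1.2 ∈ P.iter b p.1.2 := by rw [hpq]; exact hb
    obtain rfl := hP.iter_unique h2 (mem_iter_add ha hb')
    have hopen := ((isOpen_graph (P := P) a hU).prod
      (isOpen_graph (P := P) b isOpen_univ)).preimage
        (continuous_subtype_val (p := fun q : ↥P.orbitRel × ↥P.orbitRel => q.1.1.2 = q.2.1.1))
    filter_upwards [hopen.mem_nhds ⟨⟨h1, ha⟩, mem_univ _, hb⟩]
    rintro ⟨⟨p', q'⟩, hpq'⟩ ⟨⟨h1', h2'⟩, -, h3'⟩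
    refine ⟨h1', mem_iter_add h2' ?_⟩
    have hpq' : p'.1.2 = q'.1.1 := hpq'
    rw [hpq']
    exact h3'
  · refine isLocalHomeomorph_iff_isOpenEmbedding_restrict.2 fun p => ?_
    obtain ⟨n, hn⟩ := p.2
    have hopen := isOpen_graph (P := P) n isOpen_univ
    refine ⟨_, hopen.mem_nhds ⟨mem_univ _, hn⟩, .of_continuous_injective_isOpenMap
      (continuous_orbit_fst.comp continuous_subtype_val) ?_ ?_⟩
    · rintro ⟨⟨⟨x, y⟩, h⟩, -, hq⟩ ⟨⟨⟨x', y'⟩, h'⟩, -, hq'⟩ (rfl : x = x')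
      obtain rfl : y = y' := Part.mem_unique hq hq'
      rfl
    · intro W hW
      refine isOpen_iff_mem_nhds.2 ?_
      rintro _ ⟨q, hqW, rfl⟩
      have hq := q.2.2
      obtain ⟨U, hU, hqU, h⟩ := hP.exists_graph_subset (hopen.isOpenMap_subtype_val W hW)
        (mem_image_of_mem _ hqW) hq
      filter_upwards [(hU.inter (isOpen_preimage_iter n isOpen_univ)).mem_nhds
        ⟨hqU, _, mem_univ _, hq⟩]
      rintro x ⟨hxU, y, -, hy⟩
      obtain ⟨w, hw, hwx⟩ := h ⟨(x, y), n, hy⟩ hxU hy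
      exact ⟨w, hw, congrArg (fun p : ↥P.orbitRel => p.1.1) hwx⟩

/-- If `φ(K) = K`, then by compactness of `K` all `(x, φ(x))`, `x ∈ K`, lie in a single compact open
subequivalence relation of an AF groupoid, hence so do all `(x, φⁿ(x))`, `n ≥ 0`. But a compact set
meets the graphs of only finitely many `φⁿ`. -/
theorem noInvariantSet_of_isAFGroupoid [CompactSpace X] (hP : P.Aperiodic)
    (hAF : IsAFGroupoid P.orbitRel P.orbitTopology) : P.NoInvariantSet := by
  let := P.orbitTopology
  obtain ⟨-, R, hmono, hunion, hR⟩ := hAF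
  intro K hK h1 _
  by_contra hne
  obtain ⟨x, hx⟩ := nonempty_iff_ne_empty.2 hne
  have hrel : ∀ {x y}, y ∈ P.map x → (x, y) ∈ P.orbitRel := fun h => ⟨1, mem_iterNat_one.2 h⟩
  let O : ℕ → Set X := fun m => {x | ∀ y (h : y ∈ P.map x), (⟨(x, y), hrel h⟩ : ↥P.orbitRel) ∈ R m}
  have hO : Monotone O := fun m n hmn x hx y h => hmono hmn (hx y h)
  obtain ⟨m, hm⟩ : ∃ m, K ⊆ interior (O m) := by
    refine hK.isCompact.elim_directed_cover (fun m => interior (O m)) (fun _ => isOpen_interior)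
      (fun x hx => ?_) (directed_of_isDirected_le fun m n hmn => interior_mono (hO hmn))
    obtain ⟨y, -, hxy⟩ := h1 x hx
    obtain ⟨m, hm⟩ := mem_iUnion.1 (hunion.symm ▸ mem_univ (⟨(x, y), hrel hxy⟩ : ↥P.orbitRel))
    obtain ⟨U, hU, hxU, h⟩ := hP.exists_graph_subset (hR m).2.1 hm
      (n := 1) (mem_iterNat_one.2 hxy)
    exact mem_iUnion.2 ⟨m, interior_maximal
      (fun z hz w hw => h ⟨(z, w), hrel hw⟩ hz (mem_iterNat_one.2 hw)) hU hxU⟩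
  have horbit : ∀ n, ∃ y ∈ K, y ∈ P.iterNat n x ∧ ∃ h : (x, y) ∈ P.orbitRel,
      (⟨(x, y), h⟩ : ↥P.orbitRel) ∈ R m := by
    intro n
    induction n with
    | zero => exact ⟨x, hx, mem_iterNat_zero.2 rfl, (hR m).2.2.refl x⟩
    | succ n ih =>
      obtain ⟨y, hy, hxy, hR'⟩ := ih
      obtain ⟨z, hz, hyz⟩ := h1 y hy
      exact ⟨z, hz, mem_iterNat_succ.2 ⟨y, hxy, hyz⟩,
        (hR m).2.2.trans hR' ⟨hrel hyz, interior_subset (hm hy) z hyz⟩⟩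
  obtain ⟨N, hN⟩ : ∃ N : ℕ, R m ⊆ ⋃ n ∈ Iic N, ({p | p.1.2 ∈ P.iter n p.1.1} ∪
      {p | p.1.2 ∈ P.iter (-n) p.1.1} : Set ↥P.orbitRel) := by
    have hgraph : ∀ n : ℤ, IsOpen {p : ↥P.orbitRel | p.1.2 ∈ P.iter n p.1.1} := fun n => by
      simpa using isOpen_graph (P := P) n isOpen_univ
    refine (hR m).1.elim_directed_cover _
      (fun N => isOpen_biUnion fun n _ => (hgraph n).union (hgraph (-n))) (fun p _ => ?_)
      (directed_of_isDirected_le fun M N hMN => biUnion_subset_biUnion_left (Iic_subset_Iic.2 hMN))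
    obtain ⟨n, hn⟩ := p.2
    refine mem_iUnion.2 ⟨n.natAbs, mem_biUnion (mem_Iic.2 le_rfl) ?_⟩
    rcases n.natAbs_eq with h | h
    · exact Or.inl (by rw [h] at hn; simpa using hn)
    · exact Or.inr (by rw [h] at hn; simpa using hn)
  obtain ⟨y, -, hxy, h, hy⟩ := horbit (N + 1)
  obtain ⟨n, hnN, hn⟩ := mem_iUnion₂.1 (hN hy)
  have hnN : n ≤ N := hnN
  rw [← iter_natCast] at hxy
  rcases hn with hn | hn
  · have := hP.iter_unique hxy hn
    omega
  · have := hP.iter_unique hxy hn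
    omega

end OrbitTopology

section AF

variable {X : Type u} [TopologicalSpace X] [CompactSpace X] [T2Space X]
  {P : PartialDynamicalSystem X} {U : Set X}

/-- The pairs of points of the same tower over `U` form a compact open set. -/
theorem isCompact_isOpen_towerRel (hP : P.Aperiodic) (hU : IsClopen U) (hmin : P.Xmin ⊆ U)
    (hr : ∀ x, ∃ n, (P.back U)^[n] x ∈ U) :
    @IsCompact _ P.orbitTopology {p : ↥P.orbitRel | P.base U p.1.1 = P.base U p.1.2} ∧
      IsOpen[P.orbitTopology] {p : ↥P.orbitRel | P.base U p.1.1 = P.base U p.1.2} := by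
  let := P.orbitTopology
  have hf : ∀ i, Continuous (P.fwd U)^[i] := (continuous_fwd hU hmin).iterate
  have htop : ∀ i, IsClopen ((P.fwd U)^[i] ⁻¹' P.top U) := fun i =>
    (isClopen_top hU hmin).preimage (hf i)
  constructor
  · -- The relation is covered by the finitely many sets of the pairs of points at depths `i`, `j`,
    -- each of which is a continuous image of a clopen set of bottom points.
    obtain ⟨N, hN⟩ := exists_depth_le hU hmin hr
    let D : ℕ → Set X := fun k => U ∩ ⋂ i ∈ Iio k, ((P.fwd U)^[i] ⁻¹' P.top U)ᶜ
    have hD : ∀ k, IsClopen (D k) := fun k =>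
      hU.inter ((finite_Iio k).isClopen_biInter fun i _ => (htop i).compl)
    have hD' : ∀ {k : ℕ} {u : X}, u ∈ D k → u ∈ U ∧ ∀ i < k, (P.fwd U)^[i] u ∉ P.top U := fun hu =>
      ⟨hu.1, fun i hi => mem_iInter₂.1 hu.2 i hi⟩
    have hpt : ∀ {i j : ℕ} {u : X}, u ∈ D (max i j) → P.depth U ((P.fwd U)^[i] u) = i ∧
        P.base U ((P.fwd U)^[i] u) = u ∧ (P.fwd U)^[i] u ∈ P.iterNat i u := fun {i j u} hu =>
      depth_fwd_iterate hr (hD' hu).1 fun k hk => (hD' hu).2 k (hk.trans_le (le_max_left _ _))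
    have hpt' : ∀ {i j : ℕ} {u : X}, u ∈ D (max i j) → P.depth U ((P.fwd U)^[j] u) = j ∧
        P.base U ((P.fwd U)^[j] u) = u ∧ (P.fwd U)^[j] u ∈ P.iterNat j u := fun hu =>
      hpt (max_comm (α := ℕ) _ _ ▸ hu)
    have hiter : ∀ {i j : ℕ} {u : X}, u ∈ D (max i j) →
        (P.fwd U)^[j] u ∈ P.iter ((j : ℤ) - i) ((P.fwd U)^[i] u) := fun {i j u} hu =>
      mem_iter.2 ⟨i, j, u, rfl, (hpt hu).2.2, (hpt' hu).2.2⟩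
    let g : ∀ i j, ↥(D (max i j)) → ↥P.orbitRel := fun i j u =>
      ⟨((P.fwd U)^[i] u, (P.fwd U)^[j] u), _, hiter u.2⟩
    have hg : ∀ i j, Continuous (g i j) := fun i j => by
      refine continuous_generateFrom_iff.2 ?_
      rintro _ ⟨n, V, hV, rfl⟩
      have hfV : IsOpen {u : ↥(D (max i j)) | (P.fwd U)^[i] u ∈ V} :=
        hV.preimage ((hf i).comp continuous_subtype_val)
      by_cases hn : n = (j : ℤ) - i
      · convert hfV using 1
        ext u
        exact ⟨fun h => h.1, fun h => ⟨h, hn ▸ hiter u.2⟩⟩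
      · convert isOpen_empty using 1
        ext u
        exact ⟨fun h => hn (hP.iter_unique h.2 (hiter u.2)), fun h => h.elim⟩
    have hcover : {p : ↥P.orbitRel | P.base U p.1.1 = P.base U p.1.2} =
        ⋃ i ∈ Iic N, ⋃ j ∈ Iic N, range (g i j) := by
      ext p
      simp only [mem_iUnion]
      constructor
      · intro (hp : P.base U p.1.1 = P.base U p.1.2)
        obtain ⟨hx, hx'⟩ := fwd_iterate_base hmin hr p.1.1
        obtain ⟨hy, hy'⟩ := fwd_iterate_base hmin hr p.1.2
        rw [← hp] at hy hy'
        refine ⟨_, hN p.1.1, _, hN p.1.2, ⟨P.base U p.1.1, base_mem hr _,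
          mem_iInter₂.2 fun i hi => ?_⟩, Subtype.ext (Prod.ext hx hy)⟩
        rcases lt_max_iff.1 (mem_Iio.1 hi) with hi | hi
        · exact hx' i hi
        · exact hy' i hi
      · rintro ⟨i, -, j, -, u, rfl⟩
        exact (hpt u.2).2.1.trans (hpt' u.2).2.1.symm
    rw [hcover]
    refine (finite_Iic N).isCompact_biUnion fun i _ => (finite_Iic N).isCompact_biUnion fun j _ => ?_
    have := isCompact_iff_compactSpace.1 (hD (max i j)).isClosed.isCompact
    exact isCompact_range (hg i j)
  · refine isOpen_iff_mem_nhds.2 fun p (hp : P.base U p.1.1 = P.base U p.1.2) => ?_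
    set a := P.depth U p.1.1 with ha
    set b := P.depth U p.1.2 with hb
    have hmem : p.1.2 ∈ P.iter ((b : ℤ) - a) p.1.1 := mem_iter.2 ⟨a, b, P.base U p.1.1, rfl,
      mem_iterNat_base hmin hr _, hp ▸ mem_iterNat_base hmin hr _⟩
    let V : Set X := {x | P.depth U x = a} ∩ P.base U ⁻¹' ⋂ i ∈ Iio b,
      ((P.fwd U)^[i] ⁻¹' P.top U)ᶜ
    have hV : IsClopen V := (isClopen_depth hU hmin hr a).inter
      (((finite_Iio b).isClopen_biInter fun i _ => (htop i).compl).preimage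
        (continuous_base hU hmin hr))
    have hpV : p.1.1 ∈ V := ⟨rfl, mem_iInter₂.2 fun i hi => by
      rw [hp]
      exact (fwd_iterate_base hmin hr p.1.2).2 i hi⟩
    filter_upwards [(isOpen_graph (P := P) _ hV.isOpen).mem_nhds ⟨hpV, hmem⟩]
    rintro ⟨⟨x, y⟩, hxy⟩ ⟨⟨hx, hx'⟩, hy⟩
    obtain ⟨-, h2, h3⟩ := depth_fwd_iterate hr (base_mem hr x) (n := b)
      fun i hi => mem_iInter₂.1 hx' i hi
    have hx : P.depth U x = a := hx
    have hxb := mem_iterNat_base hmin hr x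
    rw [hx] at hxb
    have := mem_iter.2 ⟨a, b, P.base U x, rfl, hxb, h3⟩
    show P.base U x = P.base U y
    obtain rfl := Part.mem_unique hy this
    exact h2.symm

end AF

section Metric

variable {X : Type u} [MetricSpace X] [CompactSpace X] [TotallyDisconnectedSpace X]
  {P : PartialDynamicalSystem X}

/-- On a cycle the depth over a small neighbourhood of `Xmin` would increase at every step. -/
theorem NoInvariantSet.aperiodic (h : P.NoInvariantSet) : P.Aperiodic := by
  obtain ⟨C, hC, hC'⟩ := exists_clopen_enumeration X
  intro n x hn hx
  obtain ⟨m, hm⟩ := exists_forall_base_eq hC'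
    (fun m => h.exists_back_mem (isClopen_nbhd hC m) (P.min_subset_nbhd C m)) hx
  have := (hm m le_rfl).2
  omega

theorem NoInvariantSet.isAFGroupoid (h : P.NoInvariantSet) :
    IsAFGroupoid P.orbitRel P.orbitTopology := by
  let := P.orbitTopology
  obtain ⟨C, hC, hC'⟩ := exists_clopen_enumeration X
  have hU := fun m => isClopen_nbhd (P := P) hC m
  have hmin := P.min_subset_nbhd C
  have hr := fun m => h.exists_back_mem (hU m) (hmin m)
  refine ⟨h.aperiodic.isEtaleRelation,
    fun m => {p | P.base (P.nbhd C m) p.1.1 = P.base (P.nbhd C m) p.1.2}, ?_, ?_, fun m => ?_⟩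
  · intro m n hmn p (hp : P.base _ _ = P.base _ _)
    have hbase := fun x =>
      (base_base_of_subset (P.nbhd_anti C hmn) (hr m) (hr n) (hmin m) x).1
    show P.base _ _ = P.base _ _
    rw [← hbase, hp, hbase]
  · refine eq_univ_of_forall fun p => ?_
    obtain ⟨n, hn⟩ := p.2
    obtain ⟨a, b, u, -, hx, hy⟩ := mem_iter.1 hn
    obtain ⟨m, hm⟩ := exists_forall_base_eq hC' hr hx
    obtain ⟨m', hm'⟩ := exists_forall_base_eq hC' hr hy
    refine mem_iUnion.2 ⟨max m m', ?_⟩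
    exact (hm _ (le_max_left _ _)).1.trans (hm' _ (le_max_right _ _)).1.symm
  · obtain ⟨h1, h2⟩ := isCompact_isOpen_towerRel h.aperiodic (hU m) (hmin m) (hr m)
    refine ⟨h1, h2, fun x => ⟨P.equivalence_orbitRel.refl x, rfl⟩,
      fun ⟨hxy, h⟩ => ⟨P.equivalence_orbitRel.symm hxy, Eq.symm h⟩,
      fun ⟨hxy, h⟩ ⟨hyz, h'⟩ => ⟨P.equivalence_orbitRel.trans hxy hyz, Eq.trans h h'⟩⟩

end Metric

end PartialDynamicalSystem

/-! ### Veršik systems have no invariant sets -/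

namespace OrderedBratteliDiagram

variable {B : OrderedBratteliDiagram.{u}}

theorem mem_map_vershik {x y : B.Path} : y ∈ B.vershik.map x ↔ B.Step x y := by
  constructor
  · rintro ⟨h, rfl⟩
    exact B.vershik_step ⟨x, h⟩
  · intro h
    exact ⟨h.notMem_max, (B.vershik_step ⟨x, h.notMem_max⟩).unique h⟩

instance compactSpace_path (B : OrderedBratteliDiagram.{u}) : CompactSpace B.Path := by
  have h : {x : ∀ n, B.E n | ∀ n, B.r (x n) = B.s (x (n + 1))} =
      ⋂ n, (fun x : ∀ n, B.E n => (x n, x (n + 1))) ⁻¹' {p | B.r p.1 = B.s p.2} := by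
    ext x
    simp
  have hclosed : IsClosed {x : ∀ n, B.E n | ∀ n, B.r (x n) = B.s (x (n + 1))} := by
    rw [h]
    exact isClosed_iInter fun n => (isClosed_discrete _).preimage
      ((_root_.continuous_apply n).prodMk (_root_.continuous_apply (n + 1)))
  exact isCompact_iff_compactSpace.1 hclosed.isCompact

/-- On an invariant set all steps change edges of bounded index only, by compactness, and each step
increases the initial segment of the path in the reverse lexicographic order. This is impossible,
as there are finitely many initial segments. -/
theorem noInvariantSet_vershik (B : OrderedBratteliDiagram.{u}) : B.vershik.NoInvariantSet := by
  intro K hK h1 _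
  by_contra hne
  obtain ⟨x, hx⟩ := nonempty_iff_ne_empty.2 hne
  obtain ⟨N, hN⟩ : ∃ N : ℕ, K ⊆ ⋃ i ∈ Iic N, {y : B.Path | ¬ IsMax (y.1 i)} := by
    refine hK.isCompact.elim_directed_cover _ (fun N => isOpen_biUnion fun i _ =>
      (isOpen_discrete {e : B.E i | ¬ IsMax e}).preimage (continuous_apply i)) (fun y hy => ?_)
      (directed_of_isDirected_le fun M N hMN => biUnion_subset_biUnion_left (Iic_subset_Iic.2 hMN))
    obtain ⟨z, -, hz⟩ := h1 y hy
    obtain ⟨i, hi⟩ := not_forall.1 (mem_map_vershik.1 hz).notMem_max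
    exact mem_iUnion.2 ⟨i, mem_biUnion (mem_Iic.2 le_rfl) hi⟩
  choose! f hfK hf using h1
  have hseq : ∀ n, f^[n] x ∈ K := fun n => MapsTo.iterate hfK n hx
  let R : B.Path → B.Path → Prop := fun y z =>
    ∃ k ≤ N, y.1 k < z.1 k ∧ ∀ i, k < i → y.1 i = z.1 i
  have hR : ∀ {a b c}, R a b → R b c → R a c := by
    rintro a b c ⟨k, hk, hlt, heq⟩ ⟨l, hl, hlt', heq'⟩
    rcases lt_trichotomy k l with h | rfl | h
    · exact ⟨l, hl, heq l h ▸ hlt', fun i hi => (heq i (h.trans hi)).trans (heq' i hi)⟩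
    · exact ⟨k, hk, hlt.trans hlt', fun i hi => (heq i hi).trans (heq' i hi)⟩
    · exact ⟨k, hk, heq' k h ▸ hlt, fun i hi => (heq i hi).trans (heq' i (h.trans hi))⟩
  have hstep : ∀ y ∈ K, R y (f y) := by
    intro y hy
    obtain ⟨k, hmax, hcov, -, heq⟩ := mem_map_vershik.1 (hf y hy)
    obtain ⟨i, hi, hi'⟩ := mem_iUnion₂.1 (hN hy)
    refine ⟨k, ?_, hcov.lt, fun i hi => (heq i hi).symm⟩
    exact (not_lt.1 fun hik => hi' (hmax i hik)).trans hi
  have hchain : ∀ m n, R (f^[m] x) (f^[m + (n + 1)] x) := by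
    intro m n
    induction n with
    | zero => rw [zero_add, Function.iterate_succ_apply']; exact hstep _ (hseq m)
    | succ n ih =>
      rw [← add_assoc m, Function.iterate_succ_apply']
      exact hR ih (hstep _ (hseq _))
  obtain ⟨m, n, hmn, heq⟩ : ∃ m n, m < n ∧ ∀ i ≤ N, (f^[m] x).1 i = (f^[n] x).1 i := by
    obtain ⟨m, n, hne, heq⟩ := Finite.exists_ne_map_eq_of_infinite
      fun (n : ℕ) (i : Fin (N + 1)) => (f^[n] x).1 i
    have heq : ∀ i ≤ N, (f^[m] x).1 i = (f^[n] x).1 i := fun i hi =>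
      congrFun heq ⟨i, Nat.lt_succ_of_le hi⟩
    rcases hne.lt_or_gt with h | h
    · exact ⟨m, n, h, heq⟩
    · exact ⟨n, m, h, fun i hi => (heq i hi).symm⟩
  obtain ⟨j, rfl⟩ := Nat.exists_eq_add_of_lt hmn
  obtain ⟨k, hk, hlt, -⟩ := hchain m j
  exact hlt.ne (heq k hk)

end OrderedBratteliDiagram

namespace PartialDynamicalSystem

theorem IsConjugate.noInvariantSet {X : Type u} [TopologicalSpace X] {Y : Type v}
    [TopologicalSpace Y] {P : PartialDynamicalSystem X} {Q : PartialDynamicalSystem Y}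
    (h : P.IsConjugate Q) (hQ : Q.NoInvariantSet) : P.NoInvariantSet := by
  obtain ⟨f, -, -, hf⟩ := h
  have hmap : ∀ {x y}, y ∈ P.map x → f y ∈ Q.map (f x) := fun {x y} hxy =>
    hf x ▸ Part.mem_map f hxy
  intro K hK h1 h2
  refine image_eq_empty.1 (hQ (f '' K) (f.isClosedMap K hK) ?_ ?_)
  · rintro _ ⟨x, hx, rfl⟩
    obtain ⟨y, hy, hxy⟩ := h1 x hx
    exact ⟨f y, mem_image_of_mem f hy, hmap hxy⟩
  · rintro _ ⟨y, hy, rfl⟩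
    obtain ⟨x, hx, hxy⟩ := h2 y hy
    exact ⟨f x, mem_image_of_mem f hx, hmap hxy⟩

/-! ### Labelled towers -/

section Labels

variable {X : Type u} [TopologicalSpace X] (P : PartialDynamicalSystem X)

/-- Two points are equivalent if their towers over `U` read the same word in the classes of `S`,
from bottom to top. The top point is repeated forever, which is harmless when `S` tells top points
from others. -/
def word (U : Set X) (S : Setoid X) : Setoid X where
  r x y := ∀ k, S ((P.fwd U)^[k] (P.base U x)) ((P.fwd U)^[k] (P.base U y))
  iseqv := ⟨fun _ _ => S.refl' _, fun h k => S.symm' (h k), fun h h' k => S.trans' (h k) (h' k)⟩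

/-- The partition of the space into unions of towers over `P.nbhd C n`. The classes of the towers
over `P.nbhd C (n + 1)` record how these are stacked from towers over `P.nbhd C n`, and
tell the points in `C n` from the others. -/
noncomputable def label (C : ℕ → Set X) : ℕ → Setoid X
  | 0 => ⊤
  | n + 1 => P.word (P.nbhd C (n + 1)) (label C n ⊓ Setoid.ker (P.depth (P.nbhd C n)) ⊓
      Setoid.ker (· ∈ P.top (P.nbhd C (n + 1))) ⊓ Setoid.ker (· ∈ C n))

/-- The position in its tower over `P.nbhd C (n + 1)` of the tower over `P.nbhd C n` in which
`x` lies. -/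
noncomputable def offset (C : ℕ → Set X) (n : ℕ) (x : X) : ℕ :=
  P.depth (P.nbhd C (n + 1)) (P.base (P.nbhd C n) x)

variable {P}

theorem isOpen_word [CompactSpace X] [T2Space X] {U : Set X} (hU : IsClopen U)
    (hmin : P.Xmin ⊆ U) (hr : ∀ x, ∃ n, (P.back U)^[n] x ∈ U) {S : Setoid X}
    (hS : ∀ x, IsOpen {y | S x y}) (htop : ∀ x y, S x y → x ∈ P.top U → y ∈ P.top U) (x : X) :
    IsOpen {y | P.word U S x y} := by
  obtain ⟨n, hn⟩ := exists_fwd_iterate_mem_top hU hmin hr (base_mem hr x)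
  have hconst : ∀ {u : X}, (P.fwd U)^[n] u ∈ P.top U →
      ∀ j, (P.fwd U)^[n + j] u = (P.fwd U)^[n] u := fun {u} hu j => by
    rw [add_comm, Function.iterate_add_apply, Function.iterate_fixed (fwd_of_mem_top hu)]
  have : {y | P.word U S x y} = ⋂ k ∈ Iic n,
      (fun y => (P.fwd U)^[k] (P.base U y)) ⁻¹' {y | S ((P.fwd U)^[k] (P.base U x)) y} := by
    ext y
    simp only [mem_iInter]
    refine ⟨fun h k _ => h k, fun h k => ?_⟩
    rcases le_total k n with hk | hk
    · exact h k hk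
    · obtain ⟨j, rfl⟩ := Nat.exists_eq_add_of_le hk
      have hn' := h n (mem_Iic.2 le_rfl)
      rw [hconst hn, hconst (htop _ _ hn' hn)]
      exact hn'
  rw [this]
  exact (finite_Iic n).isOpen_biInter fun k _ =>
    (hS _).preimage (((continuous_fwd hU hmin).iterate k).comp (continuous_base hU hmin hr))

variable {C : ℕ → Set X}

theorem depth_nbhd_zero (x : X) : P.depth (P.nbhd C 0) x = 0 :=
  depth_of_mem (by rw [nbhd_zero]; trivial)

theorem label_of_base_eq {n : ℕ} {x y : X} (h : P.base (P.nbhd C n) x = P.base (P.nbhd C n) y) :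
    P.label C n x y := by
  cases n with
  | zero => trivial
  | succ n =>
    intro k
    rw [h]

section Reach

variable (hr : ∀ n x, ∃ k, (P.back (P.nbhd C n))^[k] x ∈ P.nbhd C n)
include hr

theorem label_base (n : ℕ) (x : X) : P.label C n (P.base (P.nbhd C n) x) x :=
  label_of_base_eq (base_base (hr n) x)

/-- Points at equal depth in equally labelled towers over `P.nbhd C (n + 1)` are alike with respect
to the towers over `P.nbhd C n`. -/
theorem label_succ {n : ℕ} {x y : X} (h : P.label C (n + 1) x y)
    (hd : P.depth (P.nbhd C (n + 1)) x = P.depth (P.nbhd C (n + 1)) y) :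
    P.label C n x y ∧ P.depth (P.nbhd C n) x = P.depth (P.nbhd C n) y ∧
      (x ∈ P.top (P.nbhd C (n + 1)) ↔ y ∈ P.top (P.nbhd C (n + 1))) ∧ (x ∈ C n ↔ y ∈ C n) := by
  have hmin := P.min_subset_nbhd C (n + 1)
  have hk := h (P.depth (P.nbhd C (n + 1)) x)
  rw [(fwd_iterate_base hmin (hr _) x).1, hd, (fwd_iterate_base hmin (hr _) y).1] at hk
  exact ⟨hk.1.1.1, hk.1.1.2, iff_of_eq hk.1.2, iff_of_eq hk.2⟩

theorem exists_of_label {n : ℕ} {x y : X} (h : P.label C n x y) :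
    ∃ z, P.base (P.nbhd C n) z = P.base (P.nbhd C n) x ∧
      P.depth (P.nbhd C n) z = P.depth (P.nbhd C n) y ∧
        ∀ i < P.depth (P.nbhd C n) y,
          (P.fwd (P.nbhd C n))^[i] (P.base (P.nbhd C n) x) ∉ P.top (P.nbhd C n) := by
  cases n with
  | zero => exact ⟨x, rfl, by simp [depth_nbhd_zero], by simp [depth_nbhd_zero]⟩
  | succ n =>
    have htop : ∀ i < P.depth (P.nbhd C (n + 1)) y, (P.fwd (P.nbhd C (n + 1)))^[i]
        (P.base (P.nbhd C (n + 1)) x) ∉ P.top (P.nbhd C (n + 1)) := fun i hi =>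
      (iff_of_eq (h i).1.2).not.2
        ((fwd_iterate_base (P.min_subset_nbhd C _) (hr _) y).2 i hi)
    obtain ⟨h1, h2, -⟩ := depth_fwd_iterate (hr _) (base_mem (hr _) x) htop
    exact ⟨_, h2, h1, htop⟩

/-- The towers of one class have the same height. -/
theorem depth_le_of_mem_top {n : ℕ} {x y : X} (h : P.label C n x y)
    (hx : x ∈ P.top (P.nbhd C n)) : P.depth (P.nbhd C n) y ≤ P.depth (P.nbhd C n) x := by
  by_contra! hlt
  obtain ⟨-, -, -, htop⟩ := exists_of_label hr h
  refine htop _ hlt ?_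
  rwa [(fwd_iterate_base (P.min_subset_nbhd C n) (hr n) x).1]

theorem depth_succ (n : ℕ) (x : X) : P.depth (P.nbhd C (n + 1)) x =
    P.offset C n x + P.depth (P.nbhd C n) x :=
  (base_base_of_subset (P.nbhd_anti C n.le_succ) (hr n) (hr (n + 1)) (P.min_subset_nbhd C n) x).2

theorem base_succ (n : ℕ) (x : X) : P.base (P.nbhd C (n + 1)) (P.base (P.nbhd C n) x) =
    P.base (P.nbhd C (n + 1)) x :=
  (base_base_of_subset (P.nbhd_anti C n.le_succ) (hr n) (hr (n + 1)) (P.min_subset_nbhd C n) x).1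

theorem label_of_label_succ {n : ℕ} {x y : X} (h : P.label C (n + 1) x y)
    (hd : P.offset C n x = P.offset C n y) : P.label C n x y := by
  have hx := label_of_base_eq (base_succ hr n x)
  have hy := label_of_base_eq (base_succ hr n y)
  have := (label_succ hr (Setoid.trans' _ (Setoid.trans' _ hx h) (Setoid.symm' _ hy)) hd).1
  exact Setoid.trans' _ (Setoid.trans' _ (Setoid.symm' _ (label_base hr n x)) this)
    (label_base hr n y)

/-- Among the towers over `P.nbhd C n` that are stacked in a tower over `P.nbhd C (n + 1)`, those
above the one in which `x` lies are above `x`. -/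
theorem depth_lt_offset {n : ℕ} {x y : X} (h : P.label C (n + 1) x y)
    (hlt : P.offset C n x < P.offset C n y) :
    P.depth (P.nbhd C (n + 1)) x < P.offset C n y := by
  by_contra! hle
  have hy : P.label C (n + 1) (P.base (P.nbhd C n) y) y := label_of_base_eq (base_succ hr n y)
  have hxy := Setoid.trans' _ h (Setoid.symm' _ hy)
  obtain ⟨z, hzb, hzd, -⟩ := exists_of_label hr hxy
  have hz := (label_succ hr (Setoid.trans' _ (label_of_base_eq hzb) hxy) hzd).2.1
  rw [depth_of_mem (base_mem (hr n) y)] at hz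
  have hzU : z ∈ P.nbhd C n := by simpa [hz] using iterate_depth_mem (hr n) z
  have := depth_le_depth_base (P.nbhd_anti C n.le_succ) (P.min_subset_nbhd C _) (hr n) (hr (n + 1))
    hzU hzb (hzd.trans_le hle)
  rw [hzd] at this
  exact (lt_of_lt_of_le hlt this).false

theorem isOpen_label [CompactSpace X] [T2Space X] (hC : ∀ n, IsClopen (C n)) (n : ℕ) (x : X) :
    IsOpen {y | P.label C n x y} := by
  induction n generalizing x with
  | zero => exact isOpen_univ
  | succ n ih =>
    have hU := fun n => isClopen_nbhd (P := P) hC n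
    have hmin := P.min_subset_nbhd C
    have hker : ∀ {A : Set X}, IsClopen A → ∀ x, IsOpen {y | Setoid.ker (· ∈ A) x y} :=
      fun {A} hA x => by
        have h := (DiscreteQuotient.ofIsClopen hA).isOpen_setOfPred_rel x
        convert h using 1
        ext y
        exact eq_iff_iff
    refine isOpen_word (hU _) (hmin _) (hr _) (fun x => ?_) ?_ x
    swap
    · exact fun x y h hx => (iff_of_eq h.1.2).1 hx
    refine IsOpen.inter (IsOpen.inter (IsOpen.inter (ih x) ?_) ?_) (hker (hC n) x)
    · have h := (isClopen_depth (hU n) (hmin n) (hr n) (P.depth (P.nbhd C n) x)).isOpen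
      simp only [eq_comm (b := P.depth (P.nbhd C n) x)] at h
      exact h
    · exact hker (isClopen_top (hU _) (hmin _)) x

end Reach

end Labels

end PartialDynamicalSystem

/-! ### The Bratteli diagram of a system without invariant sets -/

namespace PartialDynamicalSystem

section Diagram

variable {X : Type u} [TopologicalSpace X] (P : PartialDynamicalSystem X) (C : ℕ → Set X)

/-- The edges from the classes of towers over `P.nbhd C n` to those over `P.nbhd C (n + 1)`: an edge
consists of the class of a large tower and the position of a small tower in it. -/
def Edge (n : ℕ) : Type u :=
  ↥(range fun x : X => ((⟦x⟧ : Quotient (P.label C (n + 1))), P.offset C n x))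

/-- The edge of the tower over `P.nbhd C n` in which `x` lies. -/
noncomputable def edge (n : ℕ) (x : X) : P.Edge C n := ⟨_, x, rfl⟩

/-- Edges to the same vertex are ordered by position. -/
instance (n : ℕ) : PartialOrder (P.Edge C n) where
  le e f := e.1.1 = f.1.1 ∧ e.1.2 ≤ f.1.2
  le_refl _ := ⟨rfl, le_rfl⟩
  le_trans _ _ _ h h' := ⟨h.1.trans h'.1, h.2.trans h'.2⟩
  le_antisymm _ _ h h' := Subtype.ext (Prod.ext h.1 (h.2.antisymm h'.2))

variable {P C}

theorem exists_edge_eq {n : ℕ} (e : P.Edge C n) : ∃ x, P.edge C n x = e :=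
  e.2.imp fun _ h => Subtype.ext h

theorem edge_eq_iff {n : ℕ} {x y : X} : P.edge C n x = P.edge C n y ↔
    P.label C (n + 1) x y ∧ P.offset C n x = P.offset C n y := by
  rw [← Quotient.eq]
  exact Subtype.ext_iff.trans Prod.mk_inj

theorem edge_le_iff {n : ℕ} {x y : X} : P.edge C n x ≤ P.edge C n y ↔
    P.label C (n + 1) x y ∧ P.offset C n x ≤ P.offset C n y := by
  rw [← Quotient.eq]
  rfl

theorem edge_lt_iff {n : ℕ} {x y : X} : P.edge C n x < P.edge C n y ↔
    P.label C (n + 1) x y ∧ P.offset C n x < P.offset C n y := by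
  rw [lt_iff_le_and_ne, Ne, edge_eq_iff, edge_le_iff]
  have := @lt_iff_le_and_ne ℕ _ (P.offset C n x) (P.offset C n y)
  tauto

theorem isMin_edge {n : ℕ} {x : X} (h : P.offset C n x = 0) : IsMin (P.edge C n x) := by
  intro e he
  obtain ⟨y, rfl⟩ := exists_edge_eq e
  obtain ⟨h1, -⟩ := edge_le_iff.1 he
  exact edge_le_iff.2 ⟨Setoid.symm' _ h1, by omega⟩

theorem offset_of_mem {n : ℕ} {x : X} (h : x ∈ P.nbhd C (n + 1)) : P.offset C n x = 0 := by
  rw [offset, base_of_mem (P.nbhd_anti C n.le_succ h), depth_of_mem h]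

section Reach

variable (hr : ∀ n x, ∃ k, (P.back (P.nbhd C n))^[k] x ∈ P.nbhd C n)
include hr

theorem isMax_edge {n : ℕ} {x : X} (h : x ∈ P.top (P.nbhd C (n + 1))) : IsMax (P.edge C n x) := by
  intro e he
  obtain ⟨y, rfl⟩ := exists_edge_eq e
  obtain ⟨h1, -⟩ := edge_le_iff.1 he
  refine edge_le_iff.2 ⟨Setoid.symm' _ h1, ?_⟩
  by_contra! hlt
  have h2 := depth_lt_offset hr h1 hlt
  have h3 := depth_le_of_mem_top hr h1 h
  have h4 := depth_succ hr n y
  omega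

/-- A step from the top of one small tower to the bottom of the next, inside a large tower. -/
theorem edge_covBy {n : ℕ} {x y : X} (hxy : y ∈ P.map x) (hy : y ∈ P.nbhd C n)
    (hy' : y ∉ P.nbhd C (n + 1)) : P.edge C n x ⋖ P.edge C n y := by
  have h1 := base_of_mem_map (hr (n + 1)) hxy hy'
  have h2 := depth_of_mem_map (hr (n + 1)) hxy hy'
  have h3 : P.offset C n y = P.depth (P.nbhd C (n + 1)) x + 1 := by
    rw [offset, base_of_mem hy, h2]
  have h4 := depth_succ hr n x
  refine ⟨edge_lt_iff.2 ⟨label_of_base_eq h1.symm, by omega⟩, fun e hxe hey => ?_⟩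
  obtain ⟨w, rfl⟩ := exists_edge_eq e
  obtain ⟨h5, h6⟩ := edge_lt_iff.1 hxe
  obtain ⟨-, h7⟩ := edge_lt_iff.1 hey
  have := depth_lt_offset hr h5 h6
  omega

theorem edge_eq_of_mem_map {n : ℕ} {x y : X} (hxy : y ∈ P.map x) (hy : y ∉ P.nbhd C n) :
    P.edge C n y = P.edge C n x := by
  have hy' : y ∉ P.nbhd C (n + 1) := fun h => hy (P.nbhd_anti C n.le_succ h)
  exact edge_eq_iff.2 ⟨label_of_base_eq (base_of_mem_map (hr _) hxy hy'),
    by rw [offset, base_of_mem_map (hr n) hxy hy, offset]⟩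

/-- The first `n` edges of a point determine the class of its tower over `P.nbhd C n` and its
position in it, and vice versa. -/
theorem forall_edge_eq_iff {n : ℕ} {x y : X} : (∀ i < n, P.edge C i x = P.edge C i y) ↔
    P.label C n x y ∧ P.depth (P.nbhd C n) x = P.depth (P.nbhd C n) y := by
  induction n with
  | zero => exact ⟨fun _ => ⟨trivial, by simp [depth_nbhd_zero]⟩, fun _ i hi => by omega⟩
  | succ n ih =>
    have hx := depth_succ hr n x
    have hy := depth_succ hr n y
    rw [Nat.forall_lt_succ_right, ih, edge_eq_iff]
    constructor
    · rintro ⟨⟨h1, h2⟩, h3, h4⟩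
      exact ⟨h3, by omega⟩
    · rintro ⟨h1, h2⟩
      obtain ⟨h3, h4, -⟩ := label_succ hr h1 h2
      exact ⟨⟨h3, h4⟩, h1, by omega⟩

end Reach

variable [CompactSpace X] [T2Space X]

theorem finite_quotient_label (hP : P.NoInvariantSet) (hC : ∀ n, IsClopen (C n)) (n : ℕ) :
    Finite (Quotient (P.label C n)) := by
  have hr := fun n => hP.exists_back_mem (isClopen_nbhd hC n) (P.min_subset_nbhd C n)
  have hfin : ∀ S : DiscreteQuotient X, Finite S := fun _ => inferInstance
  exact hfin ⟨P.label C n, isOpen_label hr hC n⟩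

theorem finite_edge (hP : P.NoInvariantSet) (hC : ∀ n, IsClopen (C n)) (n : ℕ) :
    Finite (P.Edge C n) := by
  have hU := isClopen_nbhd (P := P) hC (n + 1)
  have hmin := P.min_subset_nbhd C (n + 1)
  obtain ⟨N, hN⟩ := exists_depth_le hU hmin (hP.exists_back_mem hU hmin)
  have := finite_quotient_label hP hC (n + 1)
  refine Set.Finite.to_subtype (((finite_univ).prod (finite_Iic N)).subset ?_)
  rintro _ ⟨x, rfl⟩
  exact ⟨mem_univ _, hN _⟩

theorem isOpen_edge_eq (hP : P.NoInvariantSet) (hC : ∀ n, IsClopen (C n)) (n : ℕ) (x : X) :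
    IsOpen {y | P.edge C n y = P.edge C n x} := by
  have hr := fun n => hP.exists_back_mem (isClopen_nbhd hC n) (P.min_subset_nbhd C n)
  have hU := fun n => isClopen_nbhd (P := P) hC n
  have hmin := P.min_subset_nbhd C
  have hd : Continuous (P.offset C n) :=
    (continuous_depth (hU (n + 1)) (hmin _) (hr _)).comp (continuous_base (hU n) (hmin n) (hr n))
  have : {y | P.edge C n y = P.edge C n x} =
      {y | P.label C (n + 1) x y} ∩ P.offset C n ⁻¹' {P.offset C n x} := by
    ext y
    exact eq_comm.trans (edge_eq_iff.trans (and_congr_right fun _ => eq_comm))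
  rw [this]
  exact (isOpen_label hr hC (n + 1) x).inter ((isOpen_discrete _).preimage hd)

variable [Nonempty X]

/-- The ordered Bratteli diagram whose vertices at level `n` are the classes of towers over
`P.nbhd C n`. -/
noncomputable def bratteli (hP : P.NoInvariantSet) (hC : ∀ n, IsClopen (C n)) :
    OrderedBratteliDiagram.{u} where
  V n := Quotient (P.label C n)
  E n := P.Edge C n
  finite_V := finite_quotient_label hP hC
  finite_E := finite_edge hP hC
  nonempty_V _ := ‹Nonempty X›.map (Quotient.mk _)
  subsingleton_V_zero := ⟨fun a b => Quotient.inductionOn₂ a b fun _ _ => Quotient.sound trivial⟩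
  s e := ⟦(exists_edge_eq e).choose⟧
  r e := e.1.1
  s_surjective n v := by
    have hr := fun n => hP.exists_back_mem (isClopen_nbhd hC n) (P.min_subset_nbhd C n)
    induction v using Quotient.inductionOn with
    | h x =>
      obtain ⟨h1, h2⟩ := edge_eq_iff.1 (exists_edge_eq (P.edge C n x)).choose_spec
      exact ⟨P.edge C n x, Quotient.sound (label_of_label_succ hr h1 h2)⟩
  r_surjective n v := Quotient.inductionOn v fun x => ⟨P.edge C n x, rfl⟩
  order _ := inferInstanceAs (PartialOrder (P.Edge C _))
  comparable_iff e f := by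
    constructor
    · rintro (h | h)
      · exact h.1
      · exact h.1.symm
    · intro h
      rcases le_total e.1.2 f.1.2 with h' | h'
      · exact Or.inl ⟨h, h'⟩
      · exact Or.inr ⟨Eq.symm h, h'⟩

theorem s_edge (hP : P.NoInvariantSet) (hC : ∀ n, IsClopen (C n)) (n : ℕ) (x : X) :
    (bratteli hP hC).s (P.edge C n x) = ⟦x⟧ := by
  have hr := fun n => hP.exists_back_mem (isClopen_nbhd hC n) (P.min_subset_nbhd C n)
  obtain ⟨h1, h2⟩ := edge_eq_iff.1 (exists_edge_eq (P.edge C n x)).choose_spec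
  exact Quotient.sound (label_of_label_succ hr h1 h2)

/-- The path of the edges of a point. -/
noncomputable def path (hP : P.NoInvariantSet) (hC : ∀ n, IsClopen (C n)) (x : X) :
    (bratteli hP hC).Path :=
  ⟨fun n => P.edge C n x, fun n => (s_edge hP hC (n + 1) x).symm⟩

theorem continuous_path (hP : P.NoInvariantSet) (hC : ∀ n, IsClopen (C n)) :
    Continuous (path hP hC) := by
  refine Continuous.subtype_mk (continuous_pi fun n => ?_) _
  refine continuous_discrete_rng.2 fun e => ?_
  obtain ⟨x, rfl⟩ := exists_edge_eq e
  exact isOpen_edge_eq hP hC n x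

theorem step_path (hP : P.NoInvariantSet) (hC : ∀ n, IsClopen (C n))
    (hsep : ∀ x ∉ P.Xmin, ∃ n, x ∉ P.nbhd C n) {x y : X} (hxy : y ∈ P.map x) :
    (bratteli hP hC).Step (path hP hC x) (path hP hC y) := by
  classical
  have hr := fun n => hP.exists_back_mem (isClopen_nbhd hC n) (P.min_subset_nbhd C n)
  -- The step takes place at the last level whose neighbourhood of `Xmin` contains `y`.
  have hex := hsep y (notMem_min_of_mem_map hxy)
  obtain ⟨k, hk⟩ : ∃ k, Nat.find hex = k + 1 := Nat.exists_eq_succ_of_ne_zero fun h0 => by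
    have := Nat.find_spec hex
    rw [h0, nbhd_zero] at this
    exact this trivial
  have hy : y ∉ P.nbhd C (k + 1) := hk ▸ Nat.find_spec hex
  have hlt : ∀ i ≤ k, y ∈ P.nbhd C i := fun i hi => not_not.1 (Nat.find_min hex (by omega))
  have htop : ∀ i ≤ k, x ∈ P.top (P.nbhd C i) := fun i hi z hz =>
    mem_map_unique hxy hz ▸ hlt i hi
  exact ⟨k, fun i hi => isMax_edge hr (htop (i + 1) hi), edge_covBy hr hxy (hlt k le_rfl) hy,
    fun i hi => isMin_edge (offset_of_mem (hlt (i + 1) hi)),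
    fun i hi => edge_eq_of_mem_map hr hxy fun h => hy (P.nbhd_anti C hi h)⟩

theorem path_injective (hP : P.NoInvariantSet) (hC : ∀ n, IsClopen (C n))
    (hsep : ∀ x y, (∀ n, x ∈ C n ↔ y ∈ C n) → x = y) : Function.Injective (path hP hC) := by
  have hr := fun n => hP.exists_back_mem (isClopen_nbhd hC n) (P.min_subset_nbhd C n)
  intro x y hxy
  refine hsep x y fun n => ?_
  obtain ⟨h1, h2⟩ := (forall_edge_eq_iff hr (n := n + 1)).1
    fun i _ => congrFun (congrArg Subtype.val hxy) i
  exact (label_succ hr h1 h2).2.2.2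

/-- Every finite path comes from a point: a small tower of the class prescribed by the last edge
has a point at each depth that occurs in its class. The rest is compactness. -/
theorem path_surjective (hP : P.NoInvariantSet) (hC : ∀ n, IsClopen (C n)) :
    Function.Surjective (path hP hC) := by
  have hr := fun n => hP.exists_back_mem (isClopen_nbhd hC n) (P.min_subset_nbhd C n)
  intro p
  have hfin : ∀ n, ∃ x, ∀ i < n, P.edge C i x = p.1 i := by
    intro n
    induction n with
    | zero => exact ⟨Classical.arbitrary X, by simp⟩
    | succ n ih =>
      obtain ⟨z, hz⟩ := ih
      obtain ⟨y, hy⟩ := exists_edge_eq (p.1 n)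
      have hyz : P.label C n y z := by
        cases n with
        | zero => trivial
        | succ n =>
          refine Setoid.symm' _ (Quotient.exact ?_)
          rw [← s_edge hP hC (n + 1) y, hy, ← p.2 n, ← hz n n.lt_succ_self]
          rfl
      obtain ⟨x, hxb, hxd, -⟩ := exists_of_label hr hyz
      have hxz := (forall_edge_eq_iff hr).2
        ⟨Setoid.trans' _ (label_of_base_eq hxb) hyz, hxd⟩
      refine ⟨x, Nat.forall_lt_succ_right.2 ⟨fun i hi => (hxz i hi).trans (hz i hi), ?_⟩⟩
      rw [← hy]
      refine edge_eq_iff.2 ⟨label_of_base_eq ?_, by rw [offset, hxb, offset]⟩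
      rw [← base_succ hr, hxb, base_succ hr]
  let F : ℕ → Set X := fun n => ⋂ i ∈ Iio n, {x | P.edge C i x = p.1 i}
  have hF : ∀ n, IsClosed (F n) := fun n => isClosed_biInter fun i _ =>
    (isClosed_discrete {p.1 i}).preimage
      ((OrderedBratteliDiagram.continuous_apply i).comp (continuous_path hP hC))
  obtain ⟨x, hx⟩ := IsCompact.nonempty_iInter_of_sequence_nonempty_isCompact_isClosed F
    (fun n => biInter_subset_biInter_left (Iio_subset_Iio n.le_succ))
    (fun n => (hfin n).imp fun x hx => mem_iInter₂.2 hx) (hF 0).isCompact hF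
  exact ⟨x, Subtype.ext (funext fun n =>
    mem_iInter₂.1 (mem_iInter.1 hx (n + 1)) n (mem_Iio.2 n.lt_succ_self))⟩

end Diagram

theorem NoInvariantSet.exists_isConjugate_vershik {X : Type u} [MetricSpace X] [CompactSpace X]
    [TotallyDisconnectedSpace X] [Nonempty X] {P : PartialDynamicalSystem X}
    (hP : P.NoInvariantSet) : ∃ B : OrderedBratteliDiagram.{u}, P.IsConjugate B.vershik := by
  obtain ⟨C, hC, hC'⟩ := exists_clopen_enumeration X
  have hr := fun n => hP.exists_back_mem (isClopen_nbhd hC n) (P.min_subset_nbhd C n)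
  have hinj : Function.Injective (path hP hC) := path_injective hP hC fun x y h => by
    by_contra hne
    obtain ⟨V, hV, hxV, hVy⟩ := compact_exists_isClopen_in_isOpen
      (isClosed_singleton (x := y)).isOpen_compl (show x ∈ ({y}ᶜ : Set X) from hne)
    obtain ⟨n, rfl⟩ := hC' V hV
    exact hVy ((h n).1 hxV) rfl
  have hstep : ∀ {x y}, y ∈ P.map x → (bratteli hP hC).Step (path hP hC x) (path hP hC y) :=
    step_path hP hC fun x hx => (exists_notMem_nbhd hC' hx).imp fun n hn => hn n le_rfl
  let h : X ≃ₜ (bratteli hP hC).Path := (continuous_path hP hC).homeoOfEquivCompactToT2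
    (f := Equiv.ofBijective _ ⟨hinj, path_surjective hP hC⟩)
  have hh : ∀ x, h x = path hP hC x := fun _ => rfl
  refine ⟨bratteli hP hC, h, ?_, ?_, fun x => ?_⟩
  · ext p
    obtain ⟨x, rfl⟩ := h.surjective p
    rw [h.injective.mem_set_image]
    refine ⟨fun hx n => isMax_edge hr (max_subset_top hx), fun hp => ?_⟩
    by_contra hx
    obtain ⟨y, hy⟩ := exists_mem_map hx
    exact (hstep hy).notMem_max hp
  · ext p
    obtain ⟨y, rfl⟩ := h.surjective p
    rw [h.injective.mem_set_image]
    refine ⟨fun hy n => isMin_edge (offset_of_mem (P.min_subset_nbhd C _ hy)), fun hp => ?_⟩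
    by_contra hy
    obtain ⟨x, hx⟩ := exists_mem_map_to hy
    exact (hstep hx).notMem_min hp
  · ext q
    rw [OrderedBratteliDiagram.mem_map_vershik, Part.mem_map_iff]
    constructor
    · rintro ⟨y, hy, rfl⟩
      exact hstep hy
    · intro hq
      obtain ⟨y, hy⟩ : ∃ y, y ∈ P.map x := exists_mem_map fun hx =>
        hq.notMem_max fun n => isMax_edge hr (max_subset_top hx)
      exact ⟨y, hy, (hstep hy).unique hq⟩

end PartialDynamicalSystem

theorem corollary4 {X : Type u} [MetricSpace X] [CompactSpace X] [TotallyDisconnectedSpace X]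
    [Nonempty X] (P : PartialDynamicalSystem X) :
    List.TFAE [
      P.Aperiodic ∧ IsAFGroupoid P.orbitRel P.orbitTopology,
      ∃ B : OrderedBratteliDiagram.{u}, P.IsConjugate B.vershik,
      ∀ U : Set X, IsClopen U → P.Xmin ⊆ U → (⋃ n : ℕ, (P.iter (n : ℤ)).image U) = univ,
      ∀ V : Set X, IsClopen V → P.Xmax ⊆ V → (⋃ n : ℕ, (P.iter (-(n : ℤ))).image V) = univ] := by
  have h1 : P.Aperiodic ∧ IsAFGroupoid P.orbitRel P.orbitTopology ↔ P.NoInvariantSet :=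
    ⟨fun h => PartialDynamicalSystem.noInvariantSet_of_isAFGroupoid h.1 h.2,
      fun h => ⟨h.aperiodic, h.isAFGroupoid⟩⟩
  have h2 : (∃ B : OrderedBratteliDiagram.{u}, P.IsConjugate B.vershik) ↔ P.NoInvariantSet :=
    ⟨fun ⟨B, h⟩ => h.noInvariantSet B.noInvariantSet_vershik,
      fun h => h.exists_isConjugate_vershik⟩
  have h4 : (∀ V : Set X, IsClopen V → P.Xmax ⊆ V →
      (⋃ n : ℕ, (P.iter (-(n : ℤ))).image V) = univ) ↔ P.NoInvariantSet := by
    rw [← PartialDynamicalSystem.noInvariantSet_symm_iff, PartialDynamicalSystem.noInvariantSet_iff]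
    simp only [PartialDynamicalSystem.iter_neg_natCast, PartialDynamicalSystem.iter_natCast]
    rfl
  rw [h1, h2, h4, ← PartialDynamicalSystem.noInvariantSet_iff]
  exact List.tfae_of_forall P.NoInvariantSet _ (by simp)
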